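/- **Setting.** Let $\mathcal X\subset\mathbb R^n$ be convex and compact, $y_0\in\mathbb R^m$, let $f$ be continuous and $g$ twice continuously differentiable on $\mathcal X\times\mathbb R^m$. Assume that $g$ has a Lipschitz gradient on $\mathcal X\times\mathbb R^m$, that $\nabla^2_{yy}g$ is Lipschitz there with constant $L>0$, that $g\ge\underline g$, and that for every $x\in\mathcal X$ the set $\mathcal S(x)=\{y: g(x,y)\le g(x,y_0)\}$ is compact and contained in a fixed compact set $\mathcal Y$. Let $\overline g_0,\overline f, L_f$ be constants such that $g(x,y_0)\le\overline g_0$ on $\mathcal X$, and $f$ is $L_f$-Lipschitz and $|f|\le\overline f$ on $\{(x,y): x\in\mathcal X,\ y\in\mathcal S(x)\}$. Let $\mathcal Y'$ be compact with $\mathcal Y\subset\operatorname{int}\mathcal Y'$. *Bifurcation set.* Let $\widetilde{\mathcal X}$ be the set of $x\in\mathcal X$ for which $g(x,\cdot)$ has a stationary point $y$ with $\det\nabla^2_{yy}g(x,y)=0$, and let $\widetilde{\mathcal X}_\delta=\{x\in\mathcal X:\operatorname{dist}(x,\widetilde{\mathcal X})\le\delta\}$ (empty if $\widetilde{\mathcal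 X}=\emptyset$). Assume that the upper Minkowski dimension $d=\limsup_{r\to0^+}\frac{\log N(\widetilde{\mathcal X},r)}{-\log r}$ satisfies $d<n$, where $N(A,r)$ is the least number of balls of radius $r$ that cover $A$ (and $d=0$ if $\widetilde{\mathcal X}=\emptyset$). *Lower-level method.* For each $x\in\mathcal X$ let $(y_k(x))_{k\ge0}$ be generated by the cubic-regularized Newton method with parameter $M=L$: $y_0(x)=y_0$ and $y_{k+1}(x)=y_k(x)+s_k$ with $$s_k\in\arg\min_s\Big\{\nabla_yg(x,y_k)^\top s+\tfrac12 s^\top\nabla^2_{yy}g(x,y_k)s+\tfrac M6\|s\|^3\Big\}.$$ The output $\hat y(x)$ after $K$ steps is an iterate $y_k(x)$, $0\le k\le K$, that minimizes $\max\big\{\sqrt{\tfrac1M\|\nabla_yg(x,y_k)\|},\,-\tfrac2{3M}\lambda_{\min}(\nabla^2_{yy}g(x,y_k))\big\}$. Let $\hat S(x)$ be the set of accumulation points of $(y_k(x))_k$ with the smallest value of $g(x,\cdot)$ among all its accumulation points, and let $y^{\rm cd}(x)\in\arg\min_{y\in\hat S(x)}f(x,y)$. Assume that the set of points of $\mathcal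 X\setminus\widetilde{\mathcal X}$ at which $y^{\rm cd}:\mathcal X\to\mathbb R^m$ is discontinuous has Lebesgue measure zero, and that $z\mapsto f(z,\hat y(z))$ is measurable on $\mathcal X$. *Hypergradients.* Let $h_\xi(z)=(2\pi\xi^2)^{-n/2}e^{-\|z\|^2/(2\xi^2)}$ for $\xi>0$. Read $f(z,\cdot)$ as the constant $\overline f$ for $z\notin\mathcal X$, and put $$\phi^{\rm cd}_\xi(x)=\int_{\mathbb R^n}h_\xi(x-z)f(z,y^{\rm cd}(z))\,dz,\qquad \nabla^K_x\phi^{\rm cd}_\xi(x)=\int_{\mathbb R^n}\nabla h_\xi(x-z)f(z,\hat y(z))\,dz .$$ *Requirement on $K$.* Let $\mu(\delta)>0$ and $\alpha(\delta,r)>0$ ($\delta,r>0$) be functions such that, for all $x\in\mathcal X\setminus\widetilde{\mathcal X}_\delta$: every eigenvalue $\lambda$ of $\nabla^2_{yy}g(x,y)$ at any stationary point $y\in\mathcal Y'$ of $g(x,\cdot)$ satisfies $|\lambda|\ge\mu(\delta)$; and $\|\nabla_yg(x,y)\|\ge\alpha(\delta,r)$ for all $y\in\mathcal Y$ at distance more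 than $r$ from the set of stationary points of $g(x,\cdot)$ in $\mathcal Y'$. For $\rho,\delta>0$ require $$K>\max\left\{\frac{256(\overline g_0-\underline g)L^{1/2}}{9\Big(\min\big\{\alpha(\delta,\frac{\mu(\delta)}{2L}),\frac{\mu(\delta)^2}{4L}\big\}\Big)^{3/2}},\ \frac{768(\overline g_0-\underline g)L^2}{\mu(\delta)^3}\right\}+\frac{256(\overline g_0-\underline g)L^{1/2}}{9\big(\frac{\mu(\delta)\rho}2\big)^{3/2}} .\tag{$*$}$$ **Proposition.** Functions $\mu,\alpha$ as above exist. Moreover there are constants $C_1(n,\xi)$ and $C_2(n,\xi)$, which depend only on $\xi$ and on the problem data fixed in the first two paragraphs of the setting (not on $\rho$, $\delta$, $K$, $\mu$, $\alpha$, $x$ or the choices made by the method), such that for all such $\mu,\alpha$, all $\xi,\rho,\delta>0$, every $K$ satisfying $(*)$ and every $x\in\mathbb R^n$, the function $\phi^{\rm cd}_\xi$ is differentiable at $x$, the integral $\nabla^K_x\phi^{\rm cd}_\xi(x)$ converges absolutely, and $$\big\|\nabla_x\phi^{\rm cd}_\xi(x)-\nabla^K_x\phi^{\rm cd}_\xi(x)\big\|\le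 C_1(n,\xi)\,\rho+C_2(n,\xi)\,\delta^{(n-d)/2}.$$ -/

import Mathlib

open Set Filter Topology MeasureTheory
open scoped NNReal

noncomputable section

namespace SmoothedBilevel

/-- `ℝⁿ` with the Euclidean norm. -/
abbrev Vec (n : ℕ) := EuclideanSpace ℝ (Fin n)

variable {n m : ℕ}

/-- Euclidean distance of `(x, y)` and `(x', y')` in `ℝⁿ × ℝᵐ`. -/
def pairDist (x x' : Vec n) (y y' : Vec m) : ℝ :=
  √(‖x - x'‖ ^ 2 + ‖y - y'‖ ^ 2)

/-- The partial gradient `∇_y g(x, y)`. -/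
def gradY (g : Vec n → Vec m → ℝ) (x : Vec n) (y : Vec m) : Vec m :=
  gradient (g x) y

/-- The partial Hessian `∇²_yy g(x, y)`, as an operator on `ℝᵐ`. -/
def hessY (g : Vec n → Vec m → ℝ) (x : Vec n) (y : Vec m) : Vec m →L[ℝ] Vec m :=
  fderiv ℝ (fun v => gradY g x v) y

/-- `g(x, ·)` is a Morse function: each of its stationary points is non-degenerate. -/
def IsMorseAt (g : Vec n → Vec m → ℝ) (x : Vec n) : Prop :=
  ∀ y : Vec m, gradY g x y = 0 → (hessY g x y).det ≠ 0

/-- The bifurcation point set: those `x ∈ 𝒳` for which `g(x, ·)` is not Morse. -/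
def bifurcationSet (g : Vec n → Vec m → ℝ) (X : Set (Vec n)) : Set (Vec n) :=
  {x ∈ X | ¬ IsMorseAt g x}

/-- The points of `𝒳` at distance at most `δ` from the bifurcation set (no point at all if the
bifurcation set is empty, the distance being then infinite). -/
def bifurcationNhd (g : Vec n → Vec m → ℝ) (X : Set (Vec n)) (δ : ℝ) : Set (Vec n) :=
  X ∩ Metric.cthickening δ (bifurcationSet g X)

/-- Smallest number of closed balls of radius `r` needed to cover the bounded set `A`. -/
def coverCount (A : Set (Vec n)) (r : ℝ) : ℕ :=
  (Metric.externalCoveringNumber r.toNNReal A).toNat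

/-- The upper Minkowski dimension of a bounded set (the empty set has dimension `0`). -/
def upperMinkowskiDim (A : Set (Vec n)) : ℝ :=
  limsup (fun r : ℝ => Real.log (coverCount A r) / (-Real.log r)) (𝓝[>] 0)

/-- Standing assumptions on the upper-level objective `f`, the lower-level objective `g`, the
feasible set `X`, the compact set `Y`, the initial point `y₀`, the lower bound `gLow` of `g` and
the Lipschitz constant `L` of `∇²_yy g`. -/
structure StandingAssumptions (f g : Vec n → Vec m → ℝ) (X : Set (Vec n)) (Y : Set (Vec m))
    (y₀ : Vec m) (gLow L : ℝ) : Prop where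
  f_continuous : ContinuousOn (fun p : Vec n × Vec m => f p.1 p.2) (X ×ˢ univ)
  g_contDiff : ContDiffOn ℝ 2 (fun p : Vec n × Vec m => g p.1 p.2) (X ×ˢ univ)
  X_convex : Convex ℝ X
  X_compact : IsCompact X
  /-- `g` has a Lipschitz continuous derivative on `X × ℝᵐ`. -/
  g_lipschitz_smooth : ∃ (G : Vec n × Vec m → (Vec n × Vec m →L[ℝ] ℝ)) (Lg : ℝ≥0),
    (∀ p ∈ X ×ˢ (univ : Set (Vec m)),
      HasFDerivWithinAt (fun p : Vec n × Vec m => g p.1 p.2) (G p) (X ×ˢ univ) p) ∧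
    LipschitzOnWith Lg G (X ×ˢ univ)
  L_pos : 0 < L
  hess_lipschitz : ∀ x ∈ X, ∀ x' ∈ X, ∀ y y' : Vec m,
    ‖hessY g x y - hessY g x' y'‖ ≤ L * pairDist x x' y y'
  g_lower : ∀ x ∈ X, ∀ y, gLow ≤ g x y
  Y_compact : IsCompact Y
  level_compact : ∀ x ∈ X, IsCompact {y | g x y ≤ g x y₀}
  level_subset : ∀ x ∈ X, {y | g x y ≤ g x y₀} ⊆ Y

/-! ### The cubic-regularized Newton method -/

/-- The cubic model of `g(x, ·)` at `y`, as a function of the step `s`. -/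
def cubicModel (M : ℝ) (g : Vec n → Vec m → ℝ) (x : Vec n) (y s : Vec m) : ℝ :=
  inner ℝ (gradY g x y) s + 1 / 2 * inner ℝ s (hessY g x y s) + M / 6 * ‖s‖ ^ 3

/-- `y 0, y 1, …` is a sequence of iterates of the cubic-regularized Newton method for `g(x, ·)`
started at `y₀`: each step is a global minimizer of the cubic model. -/
def IsCubicNewtonRun (M : ℝ) (g : Vec n → Vec m → ℝ) (y₀ : Vec m) (x : Vec n)
    (y : ℕ → Vec m) : Prop :=
  y 0 = y₀ ∧ ∀ (k : ℕ) (s : Vec m),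
    cubicModel M g x (y k) (y (k + 1) - y k) ≤ cubicModel M g x (y k) s

/-- Smallest eigenvalue of a self-adjoint operator, as the minimum of its Rayleigh quotient. -/
def lambdaMin (T : Vec m →L[ℝ] Vec m) : ℝ :=
  ⨅ v : Metric.sphere (0 : Vec m) 1, inner ℝ (T v) (v : Vec m)

/-- The stationarity measure by which the best iterate is selected. -/
def stationarity (M : ℝ) (g : Vec n → Vec m → ℝ) (x : Vec n) (y : Vec m) : ℝ :=
  max √(1 / M * ‖gradY g x y‖) (-(2 / (3 * M)) * lambdaMin (hessY g x y))

/-- `yhat` is the output after `K` steps: an iterate of smallest stationarity measure among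
`y 0, …, y K`. -/
def IsCubicNewtonOutput (M : ℝ) (g : Vec n → Vec m → ℝ) (x : Vec n) (y : ℕ → Vec m) (K : ℕ)
    (yhat : Vec m) : Prop :=
  ∃ k ≤ K, yhat = y k ∧ ∀ j ≤ K, stationarity M g x (y k) ≤ stationarity M g x (y j)

/-! ### The correspondence-driven hyperfunction and its smoothing -/

/-- The accumulation points of the run `y` with smallest lower-level value. -/
def attainableSet (g : Vec n → Vec m → ℝ) (x : Vec n) (y : ℕ → Vec m) : Set (Vec m) :=
  {p | MapClusterPt p atTop y ∧ ∀ q, MapClusterPt q atTop y → g x p ≤ g x q}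

/-- `p` minimizes `f(x, ·)` over the attainable set. -/
def IsCorrespondenceSolution (f g : Vec n → Vec m → ℝ) (x : Vec n) (y : ℕ → Vec m)
    (p : Vec m) : Prop :=
  p ∈ attainableSet g x y ∧ ∀ q ∈ attainableSet g x y, f x p ≤ f x q

open Classical in
/-- The function `z ↦ f(z, w(z))` on `X`, extended by the constant `fBar` outside `X`. -/
def extendedValue (f : Vec n → Vec m → ℝ) (X : Set (Vec n)) (fBar : ℝ) (w : Vec n → Vec m)
    (z : Vec n) : ℝ :=
  if z ∈ X then f z (w z) else fBar

/-- The Gaussian kernel `h_ξ` on `ℝⁿ`. -/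
def gaussKernel (ξ : ℝ) (z : Vec n) : ℝ :=
  1 / (2 * Real.pi * ξ ^ 2) ^ ((n : ℝ) / 2) * Real.exp (-‖z‖ ^ 2 / (2 * ξ ^ 2))

/-- The convolution `x ↦ ∫ h_ξ(x - z) φ(z) dz`. -/
def gaussSmooth (ξ : ℝ) (φ : Vec n → ℝ) (x : Vec n) : ℝ :=
  ∫ z, gaussKernel ξ (x - z) * φ z

/-- `∫ ∇h_ξ(x - z) φ(z) dz`. -/
def kernelGradIntegral (ξ : ℝ) (φ : Vec n → ℝ) (x : Vec n) : Vec n :=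
  ∫ z, φ z • gradient (gaussKernel ξ) (x - z)

/-! ### The requirement on the number of iterations -/

/-- `μ(δ) > 0` bounds from below the absolute value of the Hessian eigenvalues at all stationary
points in `Y'`, for all `x ∈ X` at distance more than `δ` from the bifurcation set. -/
def IsEigenvalueBound (g : Vec n → Vec m → ℝ) (X : Set (Vec n)) (Y' : Set (Vec m))
    (μ : ℝ → ℝ) : Prop :=
  ∀ δ > 0, 0 < μ δ ∧ ∀ x ∈ X \ bifurcationNhd g X δ, ∀ y ∈ Y', gradY g x y = 0 →
    ∀ l : ℝ, Module.End.HasEigenvalue (hessY g x y : Vec m →ₗ[ℝ] Vec m) l → μ δ ≤ |l|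

/-- The stationary points of `g(x, ·)` in `Y'`. -/
def critSet (g : Vec n → Vec m → ℝ) (Y' : Set (Vec m)) (x : Vec n) : Set (Vec m) :=
  {y ∈ Y' | gradY g x y = 0}

/-- `α(δ, r) > 0` bounds `‖∇_y g(x, y)‖` from below, for all `x ∈ X` at distance more than `δ`
from the bifurcation set and all `y ∈ Y` at distance more than `r` from the stationary points
in `Y'`. -/
def IsGradientBound (g : Vec n → Vec m → ℝ) (X : Set (Vec n)) (Y Y' : Set (Vec m))
    (α : ℝ → ℝ → ℝ) : Prop :=
  ∀ δ > 0, ∀ r > 0, 0 < α δ r ∧ ∀ x ∈ X \ bifurcationNhd g X δ,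
    ∀ y ∈ Y \ Metric.cthickening r (critSet g Y' x), α δ r ≤ ‖gradY g x y‖

/-- The first part `K₁` of the iteration requirement, for the values `μ = μ(δ)` and
`a = α(δ, μ(δ) / (2 L))`. -/
def iterBound₁ (gBar gLow L μ a : ℝ) : ℝ :=
  max (256 * (gBar - gLow) * L ^ ((1 : ℝ) / 2) / (9 * (min a (μ ^ 2 / (4 * L))) ^ ((3 : ℝ) / 2)))
    (768 * (gBar - gLow) * L ^ 2 / μ ^ 3)

/-- The second part `K₂` of the iteration requirement, for the value `μ = μ(δ)`. -/
def iterBound₂ (gBar gLow L μ ρ : ℝ) : ℝ :=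
  256 * (gBar - gLow) * L ^ ((1 : ℝ) / 2) / (9 * (μ * ρ / 2) ^ ((3 : ℝ) / 2))

end SmoothedBilevel

end

namespace SmoothedBilevel

/-! Both gradients are integrals against `∇h_ξ(x - z)`, so their difference is governed by `f(z, ycd
z) - f(z, yhat z)`, which vanishes outside `X`. On the `δ`-neighbourhood of the bifurcation set it
is at most `2|fBar|`, and covering numbers bound the volume of that neighbourhood by a multiple of
`δ^((n-d)/2)` (`exists_volume_inter_cthickening_le`). On the rest of `X` the output lies within `ρ`
of `ycd z` (`norm_output_sub_le`), and the Lipschitz bound on `f` applies.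

The last estimate is the core. A cubic step `s` lowers `g` by at least `L/12 ‖s‖³`, and the
stationarity measure after the step is at most `‖s‖`. Telescoping bounds the cube of the best
measure by a multiple of `1/K`. For `K` as required, the gradient at the output is below `α`, so a
stationary point `q` is close. The Hessian at `q` has no eigenvalue below `-7μ/8` and none in `(-μ,
μ)`, so it is positive definite. The run is then trapped by `q` and converges to it
(`tendsto_of_near`), so `q` is the only accumulation point and equals `ycd z`; the gradient at the
output controls its distance to `q`.

The functions `μ` and `α` exist by compactness; for `α`, nondegenerate stationary points must
persist when the parameter moves (`eventually_mem_cthickening_critSet`). -/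

/-! ### Covering numbers and the volume of neighbourhoods -/

/-- Balls of radius `r/2` about separated points are disjoint and fit in the ball of radius `R + r`;
compare volumes. -/
theorem encard_le_of_isSeparated_of_subset_closedBall {n : ℕ} {R : ℝ} {r : ℝ≥0} (hr : 0 < r)
    (hR : 0 ≤ R) {C : Set (Vec n)} (hC : C ⊆ Metric.closedBall 0 R)
    (hsep : Metric.IsSeparated r C) : C.encard ≤ (⌊((R + r) / (r / 2)) ^ n⌋₊ : ℕ∞) := by
  by_contra hlt
  push Not at hlt
  -- `C` is not known to be finite, so the volume count runs on a finite subset with one point too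
  -- many.
  obtain ⟨D, hDC, hD⟩ := Set.exists_subset_encard_eq (Order.add_one_le_of_lt hlt)
  have hDfin : D.Finite := by
    apply Set.finite_of_encard_eq_coe (k := ⌊((R + r) / (r / 2)) ^ n⌋₊ + 1)
    rw [hD]; norm_cast
  lift D to Finset (Vec n) using hDfin
  rw [Set.encard_coe_eq_coe_finsetCard] at hD
  have hcard : D.card = ⌊((R + r) / (r / 2)) ^ n⌋₊ + 1 := by exact_mod_cast hD
  have hr' : (0 : ℝ) < r := hr
  have hdisj : (D : Set (Vec n)).PairwiseDisjoint fun c => Metric.closedBall c ((r : ℝ) / 2) := by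
    intro a ha b hb hab
    apply Metric.closedBall_disjoint_closedBall
    have : (r : ENNReal) < edist a b := hsep (hDC ha) (hDC hb) hab
    rw [edist_dist, ← ENNReal.ofReal_coe_nnreal, ENNReal.ofReal_lt_ofReal_iff_of_nonneg hr'.le] at this
    linarith
  have hvol : volume.real (⋃ c ∈ D, Metric.closedBall c ((r : ℝ) / 2)) =
      ∑ c ∈ D, volume.real (Metric.closedBall c ((r : ℝ) / 2)) :=
    measureReal_biUnion_finset hdisj (fun _ _ => Metric.isClosed_closedBall.measurableSet)
      fun c _ => (measure_closedBall_lt_top).ne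
  have hsub : (⋃ c ∈ D, Metric.closedBall c ((r : ℝ) / 2)) ⊆ Metric.closedBall 0 (R + r) := by
    refine iUnion₂_subset fun c hc => ?_
    refine Metric.closedBall_subset_closedBall' ?_
    have := hC (hDC hc)
    rw [Metric.mem_closedBall] at this
    linarith
  have hle := measureReal_mono hsub (μ := volume) measure_closedBall_lt_top.ne
  rw [hvol] at hle
  simp only [Measure.addHaar_real_closedBall volume _ (by positivity : (0 : ℝ) ≤ r / 2),
    Measure.addHaar_real_closedBall volume _ (by positivity : (0 : ℝ) ≤ R + r),
    finrank_euclideanSpace, Fintype.card_fin, Finset.sum_const, nsmul_eq_mul] at hle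
  have hpos : 0 < volume.real (Metric.ball (0 : Vec n) 1) :=
    ENNReal.toReal_pos (Metric.measure_ball_pos _ _ one_pos).ne' measure_ball_lt_top.ne
  rw [← mul_assoc] at hle
  have h1 := le_of_mul_le_mul_right hle hpos
  rw [← le_div_iff₀ (by positivity), ← div_pow, hcard] at h1
  push_cast at h1
  linarith [Nat.lt_floor_add_one (((R + r) / ((r : ℝ) / 2)) ^ n)]

theorem coverCount_le {n : ℕ} {R r : ℝ} (hr : 0 < r) (hR : 0 ≤ R) {A : Set (Vec n)}
    (hA : A ⊆ Metric.closedBall 0 R) : (coverCount A r : ℝ) ≤ ((R + r) / (r / 2)) ^ n := by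
  have h : Metric.externalCoveringNumber r.toNNReal A ≤ (⌊((R + r) / (r / 2)) ^ n⌋₊ : ℕ∞) := by
    refine (Metric.externalCoveringNumber_le_coveringNumber _ _).trans
      ((Metric.coveringNumber_le_packingNumber _ _).trans ?_)
    refine iSup_le fun C => iSup_le fun hC => iSup_le fun hs => ?_
    have := encard_le_of_isSeparated_of_subset_closedBall (Real.toNNReal_pos.2 hr) hR
      (hC.trans hA) hs
    rwa [Real.coe_toNNReal _ hr.le] at this
  have h2 : coverCount A r ≤ ⌊((R + r) / (r / 2)) ^ n⌋₊ := ENat.toNat_le_of_le_natCast h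
  exact (Nat.cast_le.2 h2).trans (Nat.floor_le (by positivity))

/-- A real-valued `limsup` carries information only for a quotient that is bounded above; the crude
constant `2n` suffices for that. -/
theorem log_coverCount_div_le {n : ℕ} {R r : ℝ} (hR : 1 ≤ R) {A : Set (Vec n)}
    (hA : A ⊆ Metric.closedBall 0 R) (hr : 0 < r) (hr1 : r < 1 / (4 * R)) :
    Real.log (coverCount A r) / (-Real.log r) ≤ 2 * n := by
  have hr1' : r * (4 * R) < 1 := (lt_div_iff₀ (by positivity)).1 hr1
  have hrlt : r < 1 := by nlinarith
  have hlog : 0 < -Real.log r := by linarith [Real.log_neg hr hrlt]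
  rw [div_le_iff₀ hlog]
  rcases Nat.eq_zero_or_pos (coverCount A r) with h0 | hpos
  · rw [h0]; simp; nlinarith [Nat.cast_nonneg (α := ℝ) n]
  have h1 := coverCount_le hr (by linarith) hA
  have h2 : (R + r) / (r / 2) ≤ (r⁻¹) ^ 2 := by
    rw [div_le_iff₀ (by positivity)]
    have : r⁻¹ ^ 2 * (r / 2) = (1 / r) / 2 := by field_simp
    rw [this, le_div_iff₀ two_pos, le_div_iff₀ hr]
    nlinarith
  have h3 : (coverCount A r : ℝ) ≤ (r⁻¹) ^ (2 * n) := by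
    rw [pow_mul]
    exact h1.trans (pow_le_pow_left₀ (by positivity) h2 _)
  calc Real.log (coverCount A r) ≤ Real.log ((r⁻¹) ^ (2 * n)) :=
        Real.log_le_log (by exact_mod_cast hpos) h3
    _ = 2 * n * -Real.log r := by rw [Real.log_pow, Real.log_inv]; push_cast; ring

theorem eventually_coverCount_le {n : ℕ} {A : Set (Vec n)} (hA : Bornology.IsBounded A) {e : ℝ}
    (he : upperMinkowskiDim A < e) :
    ∃ r₀ > 0, r₀ < 1 ∧ ∀ r, 0 < r → r < r₀ → (coverCount A r : ℝ) ≤ r ^ (-e) := by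
  obtain ⟨R, hR, hAR⟩ := hA.subset_closedBall_lt 1 0
  have hbdd : IsBoundedUnder (· ≤ ·) (𝓝[>] (0 : ℝ))
      fun r : ℝ => Real.log (coverCount A r) / (-Real.log r) := by
    refine isBoundedUnder_of_eventually_le (a := 2 * (n : ℝ)) ?_
    filter_upwards [Ioo_mem_nhdsGT (show (0 : ℝ) < 1 / (4 * R) by positivity)] with r hr
    exact log_coverCount_div_le hR.le hAR hr.1 hr.2
  have hev := eventually_lt_of_limsup_lt he hbdd
  obtain ⟨u, hu, hsub⟩ := mem_nhdsGT_iff_exists_Ioo_subset.1 hev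
  refine ⟨min u (1 / 2), by simpa using hu, (min_le_right _ _).trans_lt (by norm_num), ?_⟩
  intro r hr hrlt
  have h : Real.log (coverCount A r) / (-Real.log r) < e :=
    hsub ⟨hr, hrlt.trans_le (min_le_left _ _)⟩
  have hr1 : r < 1 := (hrlt.trans_le (min_le_right _ _)).trans (by norm_num)
  have hlog : 0 < -Real.log r := by linarith [Real.log_neg hr hr1]
  rw [div_lt_iff₀ hlog] at h
  rcases Nat.eq_zero_or_pos (coverCount A r) with h0 | hpos
  · rw [h0]; simp; positivity
  rw [Real.rpow_def_of_pos hr, ← Real.log_le_iff_le_exp (by exact_mod_cast hpos)]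
  linarith

theorem volume_cthickening_le {n : ℕ} {A : Set (Vec n)} (hA : Bornology.IsBounded A) {r : ℝ}
    (hr : 0 < r) : volume.real (Metric.cthickening r A) ≤
      coverCount A r * ((3 * r) ^ n * volume.real (Metric.ball (0 : Vec n) 1)) := by
  have hr0 : r.toNNReal ≠ 0 := (Real.toNNReal_pos.2 hr).ne'
  obtain ⟨C, hC⟩ : ∃ C : {C : Set (Vec n) // Metric.IsCover r.toNNReal A C},
      C.1.encard = Metric.externalCoveringNumber r.toNNReal A := by
    have : Nonempty {C : Set (Vec n) // Metric.IsCover r.toNNReal A C} := ⟨⟨A, Metric.IsCover.rfl⟩⟩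
    obtain ⟨C, hC⟩ := ENat.exists_eq_iInf
      fun C : {C : Set (Vec n) // Metric.IsCover r.toNNReal A C} => C.1.encard
    exact ⟨C, by rw [hC, Metric.externalCoveringNumber, iInf_subtype]⟩
  obtain ⟨C, hCA⟩ := C
  have hfin : C.Finite := by
    obtain ⟨N, -, hN, hcov⟩ := Metric.exists_finite_isCover_of_isCompact_closure hr0
      hA.isCompact_closure
    refine Set.encard_lt_top_iff.1 ?_
    change C.encard = _ at hC
    rw [hC]
    exact hcov.externalCoveringNumber_le_encard.trans_lt hN.encard_lt_top
  lift C to Finset (Vec n) using hfin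
  have hcard : coverCount A r = C.card := by
    change (C : Set (Vec n)).encard = _ at hC
    rw [coverCount, ← hC, Set.encard_coe_eq_coe_finsetCard, ENat.toNat_natCast]
  have hsub : Metric.cthickening r A ⊆ ⋃ c ∈ C, Metric.closedBall c (3 * r) := by
    intro x hx
    obtain ⟨a, ha, hxa⟩ := Metric.mem_thickening_iff.1
      -- `A` need not be closed, so the distance may not be attained; the open `2r`-thickening
      -- supplies an actual point of `A`, whence the radius `3r`.
      (Metric.cthickening_subset_thickening' (by positivity) (by linarith : r < 2 * r) A hx)
    have := Metric.isCover_iff_subset_iUnion_closedBall.1 hCA ha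
    simp only [mem_iUnion, Metric.mem_closedBall, Real.coe_toNNReal _ hr.le] at this ⊢
    obtain ⟨c, hc, hac⟩ := this
    exact ⟨c, hc, (dist_triangle x a c).trans (by linarith)⟩
  have htop : volume (⋃ c ∈ C, Metric.closedBall c (3 * r)) ≠ ⊤ :=
    ((measure_biUnion_finset_le _ _).trans_lt
      (ENNReal.sum_lt_top.2 fun c _ => measure_closedBall_lt_top)).ne
  refine (measureReal_mono hsub htop).trans ((measureReal_biUnion_finset_le _ _).trans ?_)
  simp only [Measure.addHaar_real_closedBall volume _ (by positivity : (0 : ℝ) ≤ 3 * r),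
    finrank_euclideanSpace, Fintype.card_fin, Finset.sum_const, nsmul_eq_mul, hcard, le_refl]

/-- Covering numbers are at most `δ^(-e)` for small `δ` and any `e > d`. The midpoint `e = (n+d)/2`
leaves `δ^(n-e) = δ^((n-d)/2)`; for larger `δ` the volume of `B` is absorbed into the constant. -/
theorem exists_volume_inter_cthickening_le {n : ℕ} {A B : Set (Vec n)}
    (hA : Bornology.IsBounded A) (hB : Bornology.IsBounded B) (hd : upperMinkowskiDim A < n) :
    ∃ C, 0 ≤ C ∧ ∀ δ > 0, volume.real (B ∩ Metric.cthickening δ A) ≤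
      C * δ ^ ((n - upperMinkowskiDim A) / 2) := by
  set d := upperMinkowskiDim A
  have hep : 0 < (n - d) / 2 := by linarith
  obtain ⟨r₀, hr₀, -, hN⟩ := eventually_coverCount_le hA (e := (n + d) / 2) (by linarith)
  set v := volume.real (Metric.ball (0 : Vec n) 1)
  have hv : 0 ≤ v := measureReal_nonneg
  refine ⟨3 ^ n * v + volume.real B / r₀ ^ ((n - d) / 2), by positivity, fun δ hδ => ?_⟩
  rcases lt_or_ge δ r₀ with h | h
  · have h1 : volume.real (B ∩ Metric.cthickening δ A) ≤ volume.real (Metric.cthickening δ A) :=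
      measureReal_mono inter_subset_right hA.cthickening.measure_lt_top.ne
    have h2 := volume_cthickening_le hA hδ
    have h3 : (coverCount A δ : ℝ) * ((3 * δ) ^ n * v) ≤ δ ^ (-((n + d) / 2)) * ((3 * δ) ^ n * v) :=
      mul_le_mul_of_nonneg_right (hN δ hδ h) (by positivity)
    have h4 : δ ^ (-((n + d) / 2)) * ((3 * δ) ^ n * v) = 3 ^ n * v * δ ^ ((n - d) / 2) := by
      rw [mul_pow, ← Real.rpow_natCast δ n]
      have : (n - d) / 2 = -((n + d) / 2) + n := by ring
      rw [this, Real.rpow_add hδ]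
      ring
    have h5 : 0 ≤ volume.real B / r₀ ^ ((n - d) / 2) * δ ^ ((n - d) / 2) := by positivity
    nlinarith
  · have h1 : volume.real (B ∩ Metric.cthickening δ A) ≤ volume.real B :=
      measureReal_mono inter_subset_left hB.measure_lt_top.ne
    have h2 : r₀ ^ ((n - d) / 2) ≤ δ ^ ((n - d) / 2) := Real.rpow_le_rpow hr₀.le h hep.le
    have h3 : 0 < r₀ ^ ((n - d) / 2) := by positivity
    have h4 : volume.real B ≤ volume.real B / r₀ ^ ((n - d) / 2) * δ ^ ((n - d) / 2) := by
      rw [div_mul_eq_mul_div, le_div_iff₀ h3]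
      exact mul_le_mul_of_nonneg_left h2 measureReal_nonneg
    have h5 : 0 ≤ 3 ^ n * v * δ ^ ((n - d) / 2) := by positivity
    nlinarith

theorem volume_eq_zero_of_upperMinkowskiDim_lt {n : ℕ} {A : Set (Vec n)}
    (hA : Bornology.IsBounded A) (hd : upperMinkowskiDim A < n) : volume A = 0 := by
  obtain ⟨C, -, hC⟩ := exists_volume_inter_cthickening_le hA hA hd
  have htop : volume A ≠ ⊤ := hA.measure_lt_top.ne
  have hlim : Tendsto (fun δ : ℝ => C * δ ^ ((n - upperMinkowskiDim A) / 2)) (𝓝[>] 0) (𝓝 0) := by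
    have : Tendsto (fun δ : ℝ => C * δ ^ ((n - upperMinkowskiDim A) / 2)) (𝓝 0)
        (𝓝 (C * 0 ^ ((n - upperMinkowskiDim A) / 2))) :=
      (tendsto_id.rpow_const (Or.inr (by linarith))).const_mul C
    rw [Real.zero_rpow (by linarith), mul_zero] at this
    exact this.mono_left nhdsWithin_le_nhds
  have hle : volume.real A ≤ 0 := by
    refine ge_of_tendsto hlim ?_
    filter_upwards [self_mem_nhdsWithin] with δ hδ
    refine (measureReal_mono ?_ ?_).trans (hC δ hδ)
    · exact subset_inter Subset.rfl (Metric.self_subset_cthickening A)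
    · exact ((measure_mono inter_subset_left).trans_lt hA.measure_lt_top).ne
  exact (measureReal_eq_zero_iff htop).1 (le_antisymm hle measureReal_nonneg)

/-! ### Taylor estimates under a Lipschitz Hessian -/

section Taylor

variable {E : Type*} [NormedAddCommGroup E] [InnerProductSpace ℝ E]
  {h : E → ℝ} {G : E → E} {H : E → E →L[ℝ] E} {L : ℝ}

theorem hasDerivAt_add_smul {E : Type*} [NormedAddCommGroup E] [NormedSpace ℝ E] (y s : E) (t : ℝ) :
    HasDerivAt (fun t : ℝ => y + t • s) s t := by
  simpa using ((hasDerivAt_id t).smul_const s).const_add y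

theorem norm_grad_sub_linear_le (hH : ∀ y, HasFDerivAt G (H y) y)
    (hL : ∀ y y', ‖H y - H y'‖ ≤ L * ‖y - y'‖) (y s : E) :
    ‖G (y + s) - G y - H y s‖ ≤ L / 2 * ‖s‖ ^ 2 := by
  have hd : ∀ t : ℝ, HasDerivAt (fun t : ℝ => G (y + t • s) - G y - t • H y s)
      (H (y + t • s) s - H y s) t := fun t => by
    have h1 := (hH (y + t • s)).comp_hasDerivAt t (hasDerivAt_add_smul y s t)
    have h2 := (hasDerivAt_id t).smul_const (H y s)
    refine ((h1.sub_const (G y)).sub h2).congr_deriv ?_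
    simp
  have hB : ∀ t : ℝ, HasDerivAt (fun t : ℝ => L / 2 * ‖s‖ ^ 2 * t ^ 2) (L * t * ‖s‖ ^ 2) t :=
    fun t => by
      refine ((hasDerivAt_pow 2 t).const_mul (L / 2 * ‖s‖ ^ 2)).congr_deriv ?_
      push_cast; ring
  have := image_norm_le_of_norm_deriv_right_le_deriv_boundary (a := 0) (b := 1)
    (fun t _ => (hd t).continuousAt.continuousWithinAt)
    (fun t _ => (hd t).hasDerivWithinAt) (by simp) hB (fun t ht => ?_)
    (right_mem_Icc.2 zero_le_one)
  · simpa using this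
  · have h1 := hL (y + t • s) y
    rw [add_sub_cancel_left, norm_smul, Real.norm_of_nonneg ht.1] at h1
    calc ‖H (y + t • s) s - H y s‖ = ‖(H (y + t • s) - H y) s‖ := by simp
      _ ≤ ‖H (y + t • s) - H y‖ * ‖s‖ := ContinuousLinearMap.le_opNorm _ _
      _ ≤ L * (t * ‖s‖) * ‖s‖ := mul_le_mul_of_nonneg_right h1 (norm_nonneg _)
      _ = _ := by ring

/-- Along the segment, the second-order remainder has as derivative the gradient remainder paired
with `s`, so the previous bound integrates to `L/6 ‖s‖³`. -/
theorem le_cubic_upper_bound [CompleteSpace E] (hG : ∀ y, HasGradientAt h (G y) y)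
    (hH : ∀ y, HasFDerivAt G (H y) y)
    (hL : ∀ y y', ‖H y - H y'‖ ≤ L * ‖y - y'‖) (y s : E) :
    h (y + s) ≤ h y + (inner ℝ (G y) s + 1 / 2 * inner ℝ s (H y s) + L / 6 * ‖s‖ ^ 3) := by
  have hd : ∀ t : ℝ, HasDerivAt
      (fun t : ℝ => h (y + t • s) - h y - t * inner ℝ (G y) s - t ^ 2 * (inner ℝ s (H y s) / 2))
      (inner ℝ (G (y + t • s) - G y - H y (t • s)) s) t := fun t => by
    have h1 := (hG (y + t • s)).hasFDerivAt.comp_hasDerivAt t (hasDerivAt_add_smul y s t)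
    have h2 := (hasDerivAt_id t).mul_const (inner ℝ (G y) s)
    have h3 := (hasDerivAt_pow 2 t).mul_const (inner ℝ s (H y s) / 2)
    refine (((h1.sub_const (h y)).sub h2).sub h3).congr_deriv ?_
    simp only [InnerProductSpace.toDual_apply_apply, inner_sub_left, map_smul, inner_smul_left,
      real_inner_comm s (H y s)]
    simp; ring
  have hB : ∀ t : ℝ, HasDerivAt (fun t : ℝ => L / 6 * ‖s‖ ^ 3 * t ^ 3)
      (L / 2 * t ^ 2 * ‖s‖ ^ 3) t :=
    fun t => by
      refine ((hasDerivAt_pow 3 t).const_mul (L / 6 * ‖s‖ ^ 3)).congr_deriv ?_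
      push_cast; ring
  have := image_norm_le_of_norm_deriv_right_le_deriv_boundary (a := 0) (b := 1)
    (fun t _ => (hd t).continuousAt.continuousWithinAt)
    (fun t _ => (hd t).hasDerivWithinAt) (by simp) hB (fun t ht => ?_)
    (right_mem_Icc.2 zero_le_one)
  · simp only [one_smul, one_mul, one_pow, mul_one] at this
    have := (le_abs_self _).trans this
    linarith
  · have h1 := norm_grad_sub_linear_le hH hL y (t • s)
    rw [norm_smul, Real.norm_of_nonneg ht.1] at h1
    refine (norm_inner_le_norm _ _).trans
      ((mul_le_mul_of_nonneg_right h1 (norm_nonneg _)).trans (le_of_eq ?_))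
    ring

end Taylor

/-! ### Optimality conditions for the cubic model -/

section CubicStep

variable {E : Type*} [NormedAddCommGroup E] [InnerProductSpace ℝ E]
  {M : ℝ} {g s : E} {A : E →L[ℝ] E}

/-- The cubic model with gradient `g` and Hessian `A`. -/
noncomputable def cubic (M : ℝ) (g : E) (A : E →L[ℝ] E) (s : E) : ℝ :=
  inner ℝ g s + 1 / 2 * inner ℝ s (A s) + M / 6 * ‖s‖ ^ 3

theorem cubic_first_order (hA : A.IsSymmetric)
    (hmin : ∀ s', cubic M g A s ≤ cubic M g A s') : g + A s + (M / 2 * ‖s‖) • s = 0 := by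
  have hn : HasFDerivAt (fun s : E => ‖s‖ ^ 3) ((3 * ‖s‖) • innerSL ℝ s) s := by
    have := hasFDerivAt_norm_rpow s (p := 3) (by norm_num)
    norm_num at this
    exact this
  have h1 : HasFDerivAt (fun s => inner ℝ g s) (innerSL ℝ g) s := (innerSL ℝ g).hasFDerivAt
  have h2 := (hasFDerivAt_id (𝕜 := ℝ) s).inner ℝ A.hasFDerivAt
  have h3 : HasFDerivAt (cubic M g A) _ s := (h1.add (h2.const_mul (1 / 2))).add (hn.const_mul (M / 6))
  have h0 := IsLocalMin.hasFDerivAt_eq_zero (Eventually.of_forall hmin) h3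
  refine ext_inner_right ℝ fun v => ?_
  have := DFunLike.congr_fun h0 v
  simp at this
  have hs : inner ℝ (A s) v = inner ℝ s (A v) := hA s v
  simp only [inner_add_left, inner_smul_left, inner_zero_left]
  simp
  rw [real_inner_comm (A s) v] at this
  linarith

/-- A competitor of equal norm cancels the cubic term. Eliminating `g` by the first-order condition
leaves a pure quadratic in `s' - s`. -/
theorem cubic_second_order_of_norm_eq (hA : A.IsSymmetric)
    (hmin : ∀ s', cubic M g A s ≤ cubic M g A s') {s' : E} (hs : ‖s'‖ = ‖s‖) :
    0 ≤ inner ℝ (s' - s) (A (s' - s)) + M / 2 * ‖s‖ * ‖s' - s‖ ^ 2 := by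
  have h1 := hmin s'
  have hg : g = -(A s) - (M / 2 * ‖s‖) • s := by
    have := cubic_first_order hA hmin
    rw [← sub_eq_zero, ← this]; abel
  have hsym : inner ℝ (A s) s' = inner ℝ s (A s') := hA s s'
  have h2 : inner ℝ (A s) s = inner ℝ s (A s) := hA s s
  have h3 : inner ℝ s' (A s) = inner ℝ s (A s') := by rw [real_inner_comm]; exact hsym
  have h4 : inner ℝ s' s = inner ℝ s s' := real_inner_comm _ _
  rw [cubic, cubic, hs] at h1
  rw [hg] at h1
  simp only [inner_sub_left, inner_neg_left, inner_smul_left, conj_trivial,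
    real_inner_self_eq_norm_sq, hsym, h2] at h1
  rw [← real_inner_self_eq_norm_sq (s' - s)]
  simp only [inner_sub_left, inner_sub_right, map_sub, real_inner_self_eq_norm_sq, hs, h3, h4]
  nlinarith

/-- Every direction not orthogonal to `s` is that of a chord of the sphere through `s`, where the
equal-norm comparison applies; orthogonal directions follow by a limit. This uses global minimality
and is stronger than the local second-order condition. -/
theorem cubic_second_order (hA : A.IsSymmetric)
    (hmin : ∀ s', cubic M g A s ≤ cubic M g A s') (v : E) :
    0 ≤ inner ℝ v (A v) + M / 2 * ‖s‖ * ‖v‖ ^ 2 := by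
  have key : ∀ v : E, inner ℝ s v ≠ 0 → 0 ≤ inner ℝ v (A v) + M / 2 * ‖s‖ * ‖v‖ ^ 2 := by
    intro v hv
    have hv0 : v ≠ 0 := by rintro rfl; simp at hv
    have hvn : 0 < ‖v‖ ^ 2 := by positivity
    -- With this `c`, `s + c • v` is the reflection of `s` in the hyperplane orthogonal to `v`.
    set c : ℝ := -(2 * inner ℝ s v / ‖v‖ ^ 2) with hc
    have hc0 : c ≠ 0 := by
      rw [hc]; exact neg_ne_zero.2 (div_ne_zero (mul_ne_zero two_ne_zero hv) hvn.ne')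
    have hnorm : ‖s + c • v‖ = ‖s‖ := by
      rw [← sq_eq_sq₀ (norm_nonneg _) (norm_nonneg _), norm_add_sq_real, inner_smul_right,
        norm_smul, mul_pow, Real.norm_eq_abs, sq_abs]
      have : c * ‖v‖ ^ 2 = -(2 * inner ℝ s v) := by rw [hc]; field_simp
      linear_combination c * this
    have := cubic_second_order_of_norm_eq hA hmin hnorm
    rw [add_sub_cancel_left, map_smul, inner_smul_left, inner_smul_right, norm_smul, mul_pow,
      Real.norm_eq_abs, sq_abs] at this
    simp only [conj_trivial] at this
    have h2 : 0 ≤ c ^ 2 * (inner ℝ v (A v) + M / 2 * ‖s‖ * ‖v‖ ^ 2) := by linarith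
    exact nonneg_of_mul_nonneg_right h2 (by positivity)
  rcases eq_or_ne s 0 with hs | hs
  · have hg : g = 0 := by
      have := cubic_first_order hA hmin
      simpa [hs] using this
    have hpos : ∀ t > (0 : ℝ), 0 ≤ inner ℝ v (A v) + M / 3 * t * ‖v‖ ^ 3 := by
      intro t ht
      have := hmin (t • v)
      simp only [cubic, hs, hg, inner_zero_left, norm_zero, map_smul, inner_smul_left,
        inner_smul_right, norm_smul, Real.norm_of_nonneg ht.le, conj_trivial] at this
      simp at this
      have h2 : 0 ≤ t ^ 2 * (inner ℝ v (A v) + M / 3 * t * ‖v‖ ^ 3) := by linarith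
      exact nonneg_of_mul_nonneg_right h2 (by positivity)
    have hlim : Tendsto (fun t : ℝ => inner ℝ v (A v) + M / 3 * t * ‖v‖ ^ 3) (𝓝[>] 0)
        (𝓝 (inner ℝ v (A v) + M / 3 * 0 * ‖v‖ ^ 3)) :=
      (Continuous.tendsto (by fun_prop) 0).mono_left nhdsWithin_le_nhds
    have := ge_of_tendsto hlim (by filter_upwards [self_mem_nhdsWithin] with t ht using hpos t ht)
    simpa [hs] using this
  · by_cases hv : inner ℝ s v = 0
    · have hlim : Tendsto (fun t : ℝ => inner ℝ (v + t • s) (A (v + t • s)) +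
          M / 2 * ‖s‖ * ‖v + t • s‖ ^ 2) (𝓝[≠] 0)
          (𝓝 (inner ℝ (v + (0 : ℝ) • s) (A (v + (0 : ℝ) • s)) +
            M / 2 * ‖s‖ * ‖v + (0 : ℝ) • s‖ ^ 2)) :=
        (Continuous.tendsto (by fun_prop) 0).mono_left nhdsWithin_le_nhds
      have := ge_of_tendsto hlim (b := 0) (by
        filter_upwards [self_mem_nhdsWithin] with t ht
        refine key _ ?_
        rw [inner_add_right, hv, inner_smul_right, zero_add]
        exact mul_ne_zero ht (inner_self_ne_zero.2 hs))
      simpa using this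
    · exact key v hv

theorem inner_first_order (hA : A.IsSymmetric) (hmin : ∀ s', cubic M g A s ≤ cubic M g A s') :
    inner ℝ g s + inner ℝ s (A s) + M / 2 * ‖s‖ ^ 3 = 0 := by
  have := congrArg (fun w => inner ℝ w s) (cubic_first_order hA hmin)
  simp only [inner_add_left, inner_smul_left, inner_zero_left, conj_trivial,
    real_inner_self_eq_norm_sq] at this
  rw [real_inner_comm (A s) s]
  linarith

/-- Comparison with `-s` gives `⟨g, s⟩ ≤ 0`, and the first-order condition turns the model value
into `⟨g, s⟩/2 - M/12 ‖s‖³`. -/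
theorem cubic_le_of_isMin (hA : A.IsSymmetric) (hmin : ∀ s', cubic M g A s ≤ cubic M g A s') :
    cubic M g A s ≤ -(M / 12 * ‖s‖ ^ 3) := by
  have h1 := inner_first_order hA hmin
  have h2 := hmin (-s)
  simp only [cubic, inner_neg_right, map_neg, norm_neg, inner_neg_left] at h2 ⊢
  linarith

end CubicStep

/-! ### Descent and local convergence of the cubic Newton method -/

section Run

variable {E : Type*} [NormedAddCommGroup E] [InnerProductSpace ℝ E] [CompleteSpace E]
  {h : E → ℝ} {G : E → E} {H : E → E →L[ℝ] E} {L : ℝ}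

/-- Data of a function with gradient `G` and `L`-Lipschitz symmetric Hessian `H`. -/
structure HasLipschitzHessian (h : E → ℝ) (G : E → E) (H : E → E →L[ℝ] E) (L : ℝ) : Prop where
  grad : ∀ y, HasGradientAt h (G y) y
  hess : ∀ y, HasFDerivAt G (H y) y
  lip : ∀ y y', ‖H y - H y'‖ ≤ L * ‖y - y'‖
  symm : ∀ y, (H y).IsSymmetric

namespace HasLipschitzHessian

variable (hh : HasLipschitzHessian h G H L)
include hh

theorem inner_hess_ge (y y' v : E) :
    inner ℝ v (H y v) - L * ‖y - y'‖ * ‖v‖ ^ 2 ≤ inner ℝ v (H y' v) := by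
  have h1 : inner ℝ v ((H y - H y') v) ≤ L * ‖y - y'‖ * ‖v‖ ^ 2 :=
    calc inner ℝ v ((H y - H y') v) ≤ ‖v‖ * ‖(H y - H y') v‖ := real_inner_le_norm _ _
      _ ≤ ‖v‖ * (‖H y - H y'‖ * ‖v‖) := by gcongr; exact ContinuousLinearMap.le_opNorm _ _
      _ ≤ ‖v‖ * (L * ‖y - y'‖ * ‖v‖) := by gcongr; exact hh.lip y y'
      _ = _ := by ring
  rw [sub_apply, inner_sub_right] at h1
  linarith

theorem descent {y s : E} (hmin : ∀ s', cubic L (G y) (H y) s ≤ cubic L (G y) (H y) s') :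
    h (y + s) ≤ h y - L / 12 * ‖s‖ ^ 3 := by
  have h1 := le_cubic_upper_bound hh.grad hh.hess hh.lip y s
  have h2 := cubic_le_of_isMin (hh.symm y) hmin
  rw [cubic] at h2
  linarith

theorem norm_grad_step_le (hL : 0 ≤ L) {y s : E}
    (hmin : ∀ s', cubic L (G y) (H y) s ≤ cubic L (G y) (H y) s') :
    ‖G (y + s)‖ ≤ L * ‖s‖ ^ 2 := by
  have h1 := norm_grad_sub_linear_le hh.hess hh.lip y s
  have h2 := cubic_first_order (hh.symm y) hmin
  have h3 : G (y + s) = (G (y + s) - G y - H y s) - (L / 2 * ‖s‖) • s := by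
    have e : (L / 2 * ‖s‖) • s = -(G y + H y s) := eq_neg_of_add_eq_zero_right h2
    rw [e]; abel
  rw [h3]
  refine (norm_sub_le _ _).trans ?_
  rw [norm_smul, Real.norm_of_nonneg (by positivity)]
  nlinarith

/-- The second-order condition costs `L/2 ‖s‖` and the Hessian drift along the step costs `L ‖s‖`;
the sum `3L/2` explains the weight `2/(3M)` in the stationarity measure. -/
theorem inner_hess_step_ge {y s : E}
    (hmin : ∀ s', cubic L (G y) (H y) s ≤ cubic L (G y) (H y) s') (v : E) :
    -(3 * L / 2 * ‖s‖ * ‖v‖ ^ 2) ≤ inner ℝ v (H (y + s) v) := by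
  have h1 := cubic_second_order (hh.symm y) hmin v
  have h2 := hh.inner_hess_ge y (y + s) v
  rw [sub_add_cancel_left, norm_neg] at h2
  linarith

theorem sum_step_le {y : ℕ → E}
    (hmin : ∀ k s, cubic L (G (y k)) (H (y k)) (y (k + 1) - y k) ≤
      cubic L (G (y k)) (H (y k)) s) (K : ℕ) :
    ∑ k ∈ Finset.range K, L / 12 * ‖y (k + 1) - y k‖ ^ 3 ≤ h (y 0) - h (y K) := by
  induction K with
  | zero => simp
  | succ K ih =>
    have := hh.descent (hmin K)
    rw [add_sub_cancel] at this
    rw [Finset.sum_range_succ]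
    linarith

/-- Near a nondegenerate minimizer the gradient controls the distance to it. -/
theorem dist_le_of_near {μ : ℝ} (hL : 0 < L) {p : E} (hp : G p = 0)
    (hpos : ∀ v, μ * ‖v‖ ^ 2 ≤ inner ℝ v (H p v)) {y : E} (hy : ‖y - p‖ ≤ μ / (2 * L)) :
    3 / 4 * μ * ‖y - p‖ ≤ ‖G y‖ := by
  rcases (norm_nonneg (y - p)).eq_or_lt with h0 | h0
  · rw [← h0]; simp
  have h1 := norm_grad_sub_linear_le hh.hess hh.lip p (y - p)
  rw [add_sub_cancel, hp, sub_zero] at h1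
  have h2 := hpos (y - p)
  have h3 : inner ℝ (y - p) (H p (y - p)) ≤ ‖y - p‖ * ‖G y‖ + ‖y - p‖ * (L / 2 * ‖y - p‖ ^ 2) := by
    have e : H p (y - p) = G y - (G y - H p (y - p)) := by abel
    rw [e, inner_sub_right]
    have a := real_inner_le_norm (y - p) (G y)
    have b := (abs_le.1 (abs_real_inner_le_norm (y - p) (G y - H p (y - p)))).1
    have c := mul_le_mul_of_nonneg_left h1 h0.le
    linarith
  rw [le_div_iff₀ (by positivity)] at hy
  have h4 : ‖y - p‖ * (3 / 4 * μ * ‖y - p‖) ≤ ‖y - p‖ * ‖G y‖ := by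
    nlinarith [sq_nonneg ‖y - p‖]
  exact le_of_mul_le_mul_left h4 h0

/-- Within `μ/(2L)` of `p` the Hessian is still at least `μ/2`; pair the first-order condition with
`s` and drop the cubic term, which has the favourable sign. -/
theorem norm_step_le_of_near {μ : ℝ} (hL : 0 < L) {p : E}
    (hpos : ∀ v, μ * ‖v‖ ^ 2 ≤ inner ℝ v (H p v)) {y s : E} (hy : ‖y - p‖ ≤ μ / (2 * L))
    (hmin : ∀ s', cubic L (G y) (H y) s ≤ cubic L (G y) (H y) s') :
    μ / 2 * ‖s‖ ≤ ‖G y‖ := by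
  rcases (norm_nonneg s).eq_or_lt with h0 | h0
  · rw [← h0]; simp
  have h1 := inner_first_order (hh.symm y) hmin
  have h2 := hh.inner_hess_ge p y s
  have h3 := hpos s
  have h4 := (abs_le.1 (abs_real_inner_le_norm (G y) s)).1
  rw [norm_sub_rev, le_div_iff₀ (by positivity)] at hy
  have h5 : μ / 2 * ‖s‖ ^ 2 ≤ inner ℝ s (H y s) := by nlinarith [sq_nonneg ‖s‖]
  have h6 : 0 ≤ L / 2 * ‖s‖ ^ 3 := by positivity
  have h7 : ‖s‖ * (μ / 2 * ‖s‖) ≤ ‖s‖ * ‖G y‖ := by nlinarith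
  exact le_of_mul_le_mul_left h7 h0

/-- A cubic Newton sequence is trapped by a nondegenerate minimizer once it is close to it. -/
theorem tendsto_of_near {μ : ℝ} (hμ : 0 < μ) (hL : 0 < L) {p : E} (hp : G p = 0)
    (hpos : ∀ v, μ * ‖v‖ ^ 2 ≤ inner ℝ v (H p v)) {y : ℕ → E}
    (hmin : ∀ k s, cubic L (G (y k)) (H (y k)) (y (k + 1) - y k) ≤
      cubic L (G (y k)) (H (y k)) s) {k : ℕ} (hy : ‖y k - p‖ ≤ μ / (2 * L))
    (hGy : ‖G (y k)‖ ≤ 9 / 64 * (μ ^ 2 / L)) : Tendsto y atTop (𝓝 p) := by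
  -- A gradient of norm at most `9/64 μ²/L` forces distance at most `3/16 μ/L` and step at most
  -- `9/32 μ/L`. Their sum is below `1/2 μ/L`, so the next iterate stays in the ball, and `L s² ≤
  -- 9/32 μ s` contracts the gradient by `9/16`.
  have hinv : ∀ j, ‖y (j + k) - p‖ ≤ μ / (2 * L) ∧
      ‖G (y (j + k))‖ ≤ (9 / 16) ^ j * (9 / 64 * (μ ^ 2 / L)) := by
    intro j
    induction j with
    | zero => simpa using ⟨hy, hGy⟩
    | succ j ih =>
      obtain ⟨h1, h2⟩ := ih
      have hpw : ((9 : ℝ) / 16) ^ j ≤ 1 := pow_le_one₀ (by norm_num) (by norm_num)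
      have hG0 : ‖G (y (j + k))‖ ≤ 9 / 64 * (μ ^ 2 / L) :=
        h2.trans (mul_le_of_le_one_left (by positivity) hpw)
      have h3 := hh.dist_le_of_near hL hp hpos h1
      have h4 := hh.norm_step_le_of_near hL hpos h1 (hmin (j + k))
      have h5 := hh.norm_grad_step_le hL.le (hmin (j + k))
      rw [add_sub_cancel] at h5
      set s := ‖y (j + k + 1) - y (j + k)‖ with hs
      have hμL : μ ^ 2 / L = μ * (μ / L) := by ring
      have h6 : s ≤ 9 / 32 * (μ / L) := by
        refine le_of_mul_le_mul_left ?_ (half_pos hμ)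
        rw [hμL] at hG0; linarith
      have h7 : ‖y (j + k) - p‖ ≤ 3 / 16 * (μ / L) := by
        refine le_of_mul_le_mul_left ?_ (by positivity : (0 : ℝ) < 3 / 4 * μ)
        rw [hμL] at hG0; linarith
      have e : j + 1 + k = j + k + 1 := by ring
      rw [e]
      constructor
      · have : ‖y (j + k + 1) - p‖ ≤ s + ‖y (j + k) - p‖ := by
          rw [hs]; exact norm_sub_le_norm_sub_add_norm_sub _ _ _
        have h8 : 0 < μ / L := by positivity
        have h9 : μ / (2 * L) = 1 / 2 * (μ / L) := by field_simp
        rw [h9]; linarith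
      · have h8 : L * s ^ 2 ≤ 9 / 16 * ‖G (y (j + k))‖ := by
          have : s * s ≤ 9 / 32 * (μ / L) * s := mul_le_mul_of_nonneg_right h6 (norm_nonneg _)
          calc L * s ^ 2 = L * (s * s) := by ring
            _ ≤ L * (9 / 32 * (μ / L) * s) := by gcongr
            _ = 9 / 16 * (μ / 2 * s) := by field_simp; ring
            _ ≤ _ := by gcongr
        rw [pow_succ]
        linarith
  rw [← tendsto_add_atTop_iff_nat k, tendsto_iff_norm_sub_tendsto_zero]
  have hz : Tendsto (fun j : ℕ => (9 / 16 : ℝ) ^ j * (9 / 64 * (μ ^ 2 / L)) / (3 / 4 * μ)) atTop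
      (𝓝 0) := by
    have := ((tendsto_pow_atTop_nhds_zero_of_lt_one (by norm_num : (0 : ℝ) ≤ 9 / 16)
      (by norm_num)).mul_const (9 / 64 * (μ ^ 2 / L))).div_const (3 / 4 * μ)
    simpa using this
  refine squeeze_zero (fun _ => norm_nonneg _) (fun j => ?_) hz
  rw [le_div_iff₀' (by positivity)]
  exact (hh.dist_le_of_near hL hp hpos (hinv j).1).trans (hinv j).2

end HasLipschitzHessian

end Run

/-! ### Existence of the bounds `μ` and `α` -/

section Existence

variable {n m : ℕ} {f g : Vec n → Vec m → ℝ} {X : Set (Vec n)} {Y Y' : Set (Vec m)}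
  {y₀ : Vec m} {gLow L : ℝ}

/-- The Riesz isomorphism from the dual of `ℝᵐ`, as a real-linear map. -/
noncomputable def dualSymmL (m : ℕ) : (Vec m →L[ℝ] ℝ) →L[ℝ] Vec m :=
  LinearMap.mkContinuous
    { toFun := (InnerProductSpace.toDual ℝ (Vec m)).symm
      map_add' := fun a b => map_add _ a b
      map_smul' := fun c a => by simp } 1 fun a => by simp

theorem pairDist_self_left (x : Vec n) (y y' : Vec m) : pairDist x x y y' = ‖y - y'‖ := by
  simp [pairDist]

theorem pairDist_le_add (x x' : Vec n) (y y' : Vec m) :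
    pairDist x x' y y' ≤ ‖x - x'‖ + ‖y - y'‖ := by
  rw [pairDist, Real.sqrt_le_left (by positivity)]
  nlinarith [mul_nonneg (norm_nonneg (x - x')) (norm_nonneg (y - y'))]

namespace StandingAssumptions

variable (hstd : StandingAssumptions f g X Y y₀ gLow L)
include hstd

theorem contDiff_lower {x : Vec n} (hx : x ∈ X) : ContDiff ℝ 2 (g x) := by
  rw [← contDiffOn_univ]
  exact hstd.g_contDiff.comp (f := fun y : Vec m => (x, y)) (by fun_prop)
    fun y _ => ⟨hx, mem_univ _⟩

theorem hasLipschitzHessian {x : Vec n} (hx : x ∈ X) :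
    HasLipschitzHessian (g x) (gradY g x) (hessY g x) L := by
  have hc := hstd.contDiff_lower hx
  have hfd : ∀ y, DifferentiableAt ℝ (fderiv ℝ (g x)) y := fun y =>
    ((hc.fderiv_right (m := 1) (by norm_num)).differentiable (by norm_num)) y
  have hgd : ∀ y, HasFDerivAt (fun v => gradY g x v)
      ((dualSymmL m).comp (fderiv ℝ (fderiv ℝ (g x)) y)) y := fun y =>
    (dualSymmL m).hasFDerivAt.comp y (hfd y).hasFDerivAt
  refine ⟨fun y => ?_, fun y => ?_, fun y y' => ?_, fun y v w => ?_⟩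
  · exact ((hc.differentiable (by norm_num)) y).hasGradientAt
  · exact (hgd y).differentiableAt.hasFDerivAt
  · simpa [pairDist_self_left] using hstd.hess_lipschitz x hx x hx y y'
  · have hs : IsSymmSndFDerivAt ℝ (g x) y := hc.contDiffAt.isSymmSndFDerivAt (by simp)
    have he : ∀ v w : Vec m, inner ℝ (hessY g x y v) w = fderiv ℝ (fderiv ℝ (g x)) y v w :=
      fun v w => by
        rw [hessY, (hgd y).fderiv]
        exact InnerProductSpace.toDual_symm_apply
    change inner ℝ (hessY g x y v) w = inner ℝ v (hessY g x y w)
    rw [he, real_inner_comm, he, hs v w]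

/-- `X` may have empty interior, so only a derivative within `X ×ˢ univ` is available. Each slice
`{x} × ℝᵐ` lies in the domain, so its restriction to the second factor is the true derivative of `g
x`. -/
theorem continuousOn_gradY :
    ContinuousOn (fun p : Vec n × Vec m => gradY g p.1 p.2) (X ×ˢ univ) := by
  obtain ⟨D, Lg, hD, hLip⟩ := hstd.g_lipschitz_smooth
  have he : ∀ p ∈ X ×ˢ (univ : Set (Vec m)), gradY g p.1 p.2 =
      (InnerProductSpace.toDual ℝ (Vec m)).symm
        ((D p).comp (ContinuousLinearMap.inr ℝ (Vec n) (Vec m))) := by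
    rintro ⟨x, y⟩ hp
    have h1 : HasFDerivAt (fun v : Vec m => ((x, v) : Vec n × Vec m))
        (ContinuousLinearMap.inr ℝ (Vec n) (Vec m)) y := by
      exact (hasFDerivAt_const x y).prodMk (hasFDerivAt_id y)
    have h2 := (hD _ hp).comp_hasFDerivAt (f := fun v : Vec m => ((x, v) : Vec n × Vec m)) y h1
      (Eventually.of_forall fun v => ⟨hp.1, mem_univ _⟩)
    change (InnerProductSpace.toDual ℝ (Vec m)).symm (fderiv ℝ (g x) y) = _
    rw [← h2.fderiv]
    rfl
  refine ContinuousOn.congr ?_ he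
  refine (InnerProductSpace.toDual ℝ (Vec m)).symm.continuous.comp_continuousOn ?_
  exact hLip.continuousOn.clm_comp continuousOn_const

theorem continuousOn_hessY :
    ContinuousOn (fun p : Vec n × Vec m => hessY g p.1 p.2) (X ×ˢ univ) := by
  rintro ⟨x, y⟩ hp
  rw [ContinuousWithinAt, tendsto_iff_norm_sub_tendsto_zero]
  have hlim : Tendsto (fun q : Vec n × Vec m => L * pairDist q.1 x q.2 y) (𝓝[X ×ˢ univ] (x, y))
      (𝓝 (L * pairDist x x y y)) := by
    refine (Continuous.tendsto ?_ (x, y)).mono_left nhdsWithin_le_nhds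
    unfold pairDist; fun_prop
  rw [pairDist_self_left, sub_self, norm_zero, mul_zero] at hlim
  refine squeeze_zero' (Eventually.of_forall fun _ => norm_nonneg _) ?_ hlim
  filter_upwards [self_mem_nhdsWithin] with q hq
  exact hstd.hess_lipschitz _ hq.1 _ hp.1 _ _

end StandingAssumptions

/-- The points of `X` at distance at least `δ` from the bifurcation set. -/
def farSet (g : Vec n → Vec m → ℝ) (X : Set (Vec n)) (δ : ℝ) : Set (Vec n) :=
  X ∩ {x | ENNReal.ofReal δ ≤ Metric.infEDist x (bifurcationSet g X)}

/-- The complement of a closed neighbourhood is not compact; allowing distance exactly `δ` makes it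
so and keeps every point Morse. -/
theorem diff_bifurcationNhd_subset_farSet (δ : ℝ) :
    X \ bifurcationNhd g X δ ⊆ farSet g X δ := by
  rintro x ⟨hx, hxn⟩
  refine ⟨hx, ?_⟩
  rw [mem_ofPred_eq]
  by_contra h
  exact hxn ⟨hx, (not_le.1 h).le⟩

theorem isCompact_farSet (hX : IsCompact X) (δ : ℝ) : IsCompact (farSet g X δ) :=
  hX.inter_right (isClosed_le continuous_const Metric.continuous_infEDist)

theorem isMorseAt_of_mem_farSet {δ : ℝ} (hδ : 0 < δ) {x : Vec n} (hx : x ∈ farSet g X δ) :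
    IsMorseAt g x := by
  by_contra h
  have h0 : Metric.infEDist x (bifurcationSet g X) = 0 :=
    Metric.infEDist_zero_of_mem ⟨hx.1, h⟩
  have := hx.2
  rw [mem_ofPred_eq, h0] at this
  exact absurd this (not_le.2 (ENNReal.ofReal_pos.2 hδ))

theorem exists_bound_of_det_ne_zero {T : Vec m →L[ℝ] Vec m} (hT : T.det ≠ 0) :
    ∃ c > 0, ∀ v, c * ‖v‖ ≤ ‖T v‖ := by
  set e := T.toContinuousLinearEquivOfDetNeZero hT
  have he : ∀ v, e v = T v := fun v => rfl
  refine ⟨(‖(e.symm : Vec m →L[ℝ] Vec m)‖ + 1)⁻¹, by positivity, fun v => ?_⟩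
  rw [inv_mul_le_iff₀ (by positivity)]
  calc ‖v‖ = ‖(e.symm : Vec m →L[ℝ] Vec m) (T v)‖ := by
        rw [← he]; simp
    _ ≤ ‖(e.symm : Vec m →L[ℝ] Vec m)‖ * ‖T v‖ := ContinuousLinearMap.le_opNorm _ _
    _ ≤ _ := by gcongr; linarith

/-- By compactness a local bound is enough: near a nonstationary point the claim is vacuous, and
near a stationary one the Hessian is invertible and keeps half of its lower bound. -/
theorem exists_hess_bound (hstd : StandingAssumptions f g X Y y₀ gLow L) (hY' : IsCompact Y')
    {δ : ℝ} (hδ : 0 < δ) :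
    ∃ c > 0, ∀ p ∈ farSet g X δ ×ˢ Y', gradY g p.1 p.2 = 0 → ∀ v,
      c * ‖v‖ ≤ ‖hessY g p.1 p.2 v‖ := by
  refine IsCompact.induction_on ((isCompact_farSet (g := g) hstd.X_compact δ).prod hY')
    (p := fun s => ∃ c > 0, ∀ p ∈ s, gradY g p.1 p.2 = 0 → ∀ v, c * ‖v‖ ≤ ‖hessY g p.1 p.2 v‖)
    ⟨1, one_pos, by simp⟩ ?_ ?_ ?_
  · rintro s t hst ⟨c, hc, h⟩
    exact ⟨c, hc, fun p hp => h p (hst hp)⟩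
  · rintro s t ⟨c, hc, h⟩ ⟨c', hc', h'⟩
    refine ⟨min c c', lt_min hc hc', ?_⟩
    rintro p (hp | hp) h0 v
    · exact (mul_le_mul_of_nonneg_right (min_le_left _ _) (norm_nonneg _)).trans (h p hp h0 v)
    · exact (mul_le_mul_of_nonneg_right (min_le_right _ _) (norm_nonneg _)).trans (h' p hp h0 v)
  · rintro ⟨x, y⟩ ⟨hx, hy⟩
    have hsub : farSet g X δ ×ˢ Y' ⊆ X ×ˢ univ := prod_mono inter_subset_left (subset_univ _)
    by_cases h0 : gradY g x y = 0
    · obtain ⟨c, hc, hcv⟩ := exists_bound_of_det_ne_zero (isMorseAt_of_mem_farSet hδ hx y h0)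
      have hcont := (hstd.continuousOn_hessY (x, y) ⟨hx.1, mem_univ _⟩).mono hsub
      rw [Metric.continuousWithinAt_iff'] at hcont
      refine ⟨_, hcont (c / 2) (half_pos hc), c / 2, half_pos hc, fun q hq _ v => ?_⟩
      rw [mem_ofPred_eq, dist_eq_norm] at hq
      have h1 : ‖(hessY g x y - hessY g q.1 q.2) v‖ ≤ c / 2 * ‖v‖ :=
        (ContinuousLinearMap.le_opNorm _ _).trans
          (mul_le_mul_of_nonneg_right (by rw [norm_sub_rev]; exact hq.le) (norm_nonneg _))
      have h2 := hcv v
      have h3 := norm_sub_norm_le (hessY g x y v) (hessY g q.1 q.2 v)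
      rw [sub_apply] at h1
      linarith
    · have hcont := (hstd.continuousOn_gradY (x, y) ⟨hx.1, mem_univ _⟩).mono hsub
      exact ⟨_, hcont.eventually_ne h0, 1, one_pos, fun q hq h => absurd h hq⟩

theorem exists_isEigenvalueBound (hstd : StandingAssumptions f g X Y y₀ gLow L)
    (hY' : IsCompact Y') : ∃ μ : ℝ → ℝ, IsEigenvalueBound g X Y' μ := by
  have : ∀ δ : ℝ, ∃ c : ℝ, 0 < δ → 0 < c ∧ ∀ p ∈ farSet g X δ ×ˢ Y', gradY g p.1 p.2 = 0 → ∀ v,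
      c * ‖v‖ ≤ ‖hessY g p.1 p.2 v‖ := by
    intro δ
    by_cases hδ : 0 < δ
    · obtain ⟨c, hc, h⟩ := exists_hess_bound hstd hY' hδ
      exact ⟨c, fun _ => ⟨hc, h⟩⟩
    · exact ⟨0, fun h => absurd h hδ⟩
  choose μ hμ using this
  refine ⟨μ, fun δ hδ => ⟨(hμ δ hδ).1, fun x hx y hy h0 l hl => ?_⟩⟩
  obtain ⟨v, hv⟩ := hl.exists_hasEigenvector
  have h1 := (hμ δ hδ).2 (x, y) ⟨diff_bifurcationNhd_subset_farSet δ hx, hy⟩ h0 v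
  have h2 : hessY g x y v = l • v := hv.apply_eq_smul
  simp only [h2, norm_smul, Real.norm_eq_abs] at h1
  exact le_of_mul_le_mul_right h1 (norm_pos_iff.2 hv.2)

/-- Nondegenerate stationary points persist under small perturbations of the parameter. -/
theorem eventually_mem_cthickening_critSet (hstd : StandingAssumptions f g X Y y₀ gLow L)
    {r : ℝ} (hr : 0 < r) {x : Vec n} {y : Vec m} (hx : x ∈ X) (hy : Y' ∈ 𝓝 y)
    (h0 : gradY g x y = 0) (hdet : (hessY g x y).det ≠ 0) :
    ∀ᶠ q : Vec n × Vec m in 𝓝[X ×ˢ univ] (x, y), q.2 ∈ Metric.cthickening r (critSet g Y' q.1) := by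
  have hL := hstd.L_pos
  set e := (hessY g x y).toContinuousLinearEquivOfDetNeZero hdet
  have he : ∀ v, e v = hessY g x y v := fun v => rfl
  set N : ℝ≥0 := ‖(e.symm : Vec m →L[ℝ] Vec m)‖₊ + 1 with hNdef
  have hN : (0 : ℝ) < N := by rw [hNdef]; positivity
  let e' : (hessY g x y).NonlinearRightInverse :=
    { toFun := e.symm
      nnnorm := N
      bound' := fun v => by
        refine ((e.symm : Vec m →L[ℝ] Vec m).le_opNorm v).trans ?_
        gcongr
        rw [hNdef]; push_cast; linarith
      right_inv' := fun v => by rw [← he]; simp }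
  obtain ⟨ε₁, hε₁, hball⟩ := Metric.nhds_basis_closedBall.mem_iff.1 hy
  -- `ε₁` keeps the new stationary point in `Y'`, `r/2` keeps it within `r` of the perturbed `y'`,
  -- and the last term keeps the Hessian within `1/(2N)` of `hessY g x y`.
  set ε := min ε₁ (min (r / 2) (1 / (4 * N * L))) with hε_def
  have hε : 0 < ε := by rw [hε_def]; positivity
  have hεr : ε ≤ r / 2 := (min_le_right _ _).trans (min_le_left _ _)
  have hεN : L * (2 * ε) ≤ 1 / (2 * N) := by
    have h1 : ε ≤ 1 / (4 * N * L) := (min_le_right _ _).trans (min_le_right _ _)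
    rw [le_div_iff₀ (by positivity)] at h1 ⊢
    linarith
  have hcont : Tendsto (fun q : Vec n × Vec m => gradY g q.1 y) (𝓝[X ×ˢ univ] (x, y)) (𝓝 0) := by
    have h1 := hstd.continuousOn_gradY (x, y) ⟨hx, mem_univ _⟩
    rw [ContinuousWithinAt] at h1
    simp only [h0] at h1
    refine h1.comp (f := fun q : Vec n × Vec m => (q.1, y)) ?_
    refine tendsto_nhdsWithin_iff.2 ⟨?_, ?_⟩
    · exact (Continuous.tendsto (by fun_prop : Continuous fun q : Vec n × Vec m => (q.1, y))
        (x, y)).mono_left nhdsWithin_le_nhds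
    · filter_upwards [self_mem_nhdsWithin] with q hq using ⟨hq.1, mem_univ _⟩
  have hgrad : ∀ᶠ q : Vec n × Vec m in 𝓝[X ×ˢ univ] (x, y), ‖gradY g q.1 y‖ < ε / (2 * N) := by
    have := hcont.norm
    rw [norm_zero] at this
    exact this.eventually_lt_const (by positivity)
  have hnear : ∀ᶠ q : Vec n × Vec m in 𝓝[X ×ˢ univ] (x, y), dist q (x, y) < ε :=
    nhdsWithin_le_nhds (Metric.ball_mem_nhds _ hε)
  filter_upwards [hgrad, hnear, self_mem_nhdsWithin] with q hq hqd hqX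
  obtain ⟨x', y'⟩ := q
  rw [Prod.dist_eq, max_lt_iff] at hqd
  simp only at hq hqd ⊢
  have hx' : x' ∈ X := hqX.1
  have hh := hstd.hasLipschitzHessian hx'
  have happ : ApproximatesLinearOn (gradY g x') (hessY g x y) (Metric.closedBall y ε)
      (1 / (2 * N)) := by
    intro a ha b hb
    refine (convex_closedBall y ε).norm_image_sub_le_of_norm_hasFDerivWithin_le'
      (fun w _ => (hh.hess w).hasFDerivWithinAt) (fun w hw => ?_) hb ha
    have h1 := hstd.hess_lipschitz x' hx' x hx w y
    have h2 := pairDist_le_add x' x w y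
    rw [Metric.mem_closedBall, dist_eq_norm] at hw
    rw [dist_eq_norm] at hqd
    push_cast
    calc _ ≤ L * pairDist x' x w y := h1
      _ ≤ L * (2 * ε) := by gcongr; linarith [hqd.1]
      _ ≤ _ := hεN
  -- Quantitative inverse function theorem: the image of the `ε`-ball contains a ball of radius
  -- `(1/N - 1/(2N)) ε` about `gradY g x' y`, hence `0`.
  have hsurj := happ.surjOn_closedBall_of_nonlinearRightInverse e' hε.le Subset.rfl
  obtain ⟨w, hw, hw0⟩ := hsurj (show (0 : Vec m) ∈ _ by
    rw [Metric.mem_closedBall, dist_zero_left]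
    refine hq.le.trans (le_of_eq ?_)
    change _ = ((N : ℝ)⁻¹ - ((1 / (2 * N) : ℝ≥0) : ℝ)) * ε
    push_cast
    field_simp
    norm_num)
  refine Metric.mem_cthickening_of_dist_le y' w r _
    ⟨hball (Metric.closedBall_subset_closedBall (min_le_left _ _) hw), hw0⟩ ?_
  rw [Metric.mem_closedBall] at hw
  have := dist_triangle_right y' w y
  linarith [hqd.2]

/-- Again local by compactness: near a nonstationary pair continuity gives the bound, near a
stationary one persistence makes it vacuous. Persistence inside `Y'` is why `Y` must lie in its
interior. -/
theorem exists_grad_bound (hstd : StandingAssumptions f g X Y y₀ gLow L)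
    (hYY' : Y ⊆ interior Y') {δ r : ℝ} (hδ : 0 < δ) (hr : 0 < r) :
    ∃ c > 0, ∀ p ∈ farSet g X δ ×ˢ Y, p.2 ∉ Metric.cthickening r (critSet g Y' p.1) →
      c ≤ ‖gradY g p.1 p.2‖ := by
  refine IsCompact.induction_on ((isCompact_farSet (g := g) hstd.X_compact δ).prod hstd.Y_compact)
    (p := fun s => ∃ c > 0, ∀ p ∈ s, p.2 ∉ Metric.cthickening r (critSet g Y' p.1) →
      c ≤ ‖gradY g p.1 p.2‖) ⟨1, one_pos, by simp⟩ ?_ ?_ ?_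
  · rintro s t hst ⟨c, hc, h⟩
    exact ⟨c, hc, fun p hp => h p (hst hp)⟩
  · rintro s t ⟨c, hc, h⟩ ⟨c', hc', h'⟩
    refine ⟨min c c', lt_min hc hc', ?_⟩
    rintro p (hp | hp) h0
    · exact (min_le_left _ _).trans (h p hp h0)
    · exact (min_le_right _ _).trans (h' p hp h0)
  · rintro ⟨x, y⟩ ⟨hx, hy⟩
    have hsub : farSet g X δ ×ˢ Y ⊆ X ×ˢ univ := prod_mono inter_subset_left (subset_univ _)
    by_cases h0 : gradY g x y = 0
    · have hev := eventually_mem_cthickening_critSet hstd hr hx.1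
        (mem_interior_iff_mem_nhds.1 (hYY' hy)) h0 (isMorseAt_of_mem_farSet hδ hx y h0)
      exact ⟨_, nhdsWithin_mono _ hsub hev, 1, one_pos, fun q hq h => absurd hq h⟩
    · have hcont := ((hstd.continuousOn_gradY (x, y) ⟨hx.1, mem_univ _⟩).mono hsub).norm
      have hpos : 0 < ‖gradY g x y‖ := norm_pos_iff.2 h0
      exact ⟨_, hcont.eventually_const_lt (half_lt_self hpos), _, half_pos hpos,
        fun q hq _ => le_of_lt hq⟩

theorem exists_isGradientBound (hstd : StandingAssumptions f g X Y y₀ gLow L)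
    (hYY' : Y ⊆ interior Y') : ∃ α : ℝ → ℝ → ℝ, IsGradientBound g X Y Y' α := by
  have : ∀ δ r : ℝ, ∃ c : ℝ, 0 < δ → 0 < r → 0 < c ∧ ∀ p ∈ farSet g X δ ×ˢ Y,
      p.2 ∉ Metric.cthickening r (critSet g Y' p.1) → c ≤ ‖gradY g p.1 p.2‖ := by
    intro δ r
    by_cases h : 0 < δ ∧ 0 < r
    · obtain ⟨c, hc, hb⟩ := exists_grad_bound hstd hYY' h.1 h.2
      exact ⟨c, fun _ _ => ⟨hc, hb⟩⟩
    · exact ⟨0, fun h1 h2 => absurd ⟨h1, h2⟩ h⟩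
  choose α hα using this
  refine ⟨α, fun δ hδ r hr => ⟨(hα δ r hδ hr).1, fun x hx y hy => ?_⟩⟩
  exact (hα δ r hδ hr).2 (x, y) ⟨diff_bifurcationNhd_subset_farSet δ hx, hy.1⟩ hy.2

end Existence

/-! ### Accuracy of the output after `K` steps -/

section Output

variable {n m : ℕ} {f g : Vec n → Vec m → ℝ} {X : Set (Vec n)} {Y Y' : Set (Vec m)}
  {y₀ : Vec m} {gLow L : ℝ}

theorem neg_norm_le_inner (T : Vec m →L[ℝ] Vec m) (v : Vec m) :
    -(‖T‖ * ‖v‖ ^ 2) ≤ inner ℝ (T v) v := by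
  have h1 := (abs_le.1 (abs_real_inner_le_norm (T v) v)).1
  nlinarith [T.le_opNorm v, norm_nonneg v]

theorem lambdaMin_mul_le (T : Vec m →L[ℝ] Vec m) (v : Vec m) :
    lambdaMin T * ‖v‖ ^ 2 ≤ inner ℝ v (T v) := by
  rcases eq_or_ne v 0 with rfl | hv
  · simp
  have hv0 : 0 < ‖v‖ := norm_pos_iff.2 hv
  have hbdd : BddBelow (range fun v : Metric.sphere (0 : Vec m) 1 => inner ℝ (T v) (v : Vec m)) := by
    refine ⟨-‖T‖, ?_⟩
    rintro _ ⟨w, rfl⟩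
    have := neg_norm_le_inner T w
    simpa [mem_sphere_zero_iff_norm.1 w.2] using this
  have h := ciInf_le hbdd ⟨‖v‖⁻¹ • v, by simp [norm_smul, hv0.ne']⟩
  simp only [map_smul, inner_smul_left, inner_smul_right, conj_trivial] at h
  rw [real_inner_comm]
  calc lambdaMin T * ‖v‖ ^ 2 ≤ ‖v‖⁻¹ * (‖v‖⁻¹ * inner ℝ (T v) v) * ‖v‖ ^ 2 := by gcongr; exact h
    _ = _ := by field_simp

/-- The sign of `c` matters only for `m = 0`, where the sphere is empty and the infimum defaults to
`0`. -/
theorem le_lambdaMin {T : Vec m →L[ℝ] Vec m} {c : ℝ} (hc : 0 ≤ c)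
    (h : ∀ v, -(c * ‖v‖ ^ 2) ≤ inner ℝ v (T v)) : -c ≤ lambdaMin T := by
  rcases isEmpty_or_nonempty (Metric.sphere (0 : Vec m) 1) with he | he
  · rw [lambdaMin, Real.iInf_of_isEmpty]; linarith
  · refine le_ciInf fun v => ?_
    have := h v
    rw [real_inner_comm]
    simpa [mem_sphere_zero_iff_norm.1 v.2] using this

/-- The infimum of the Rayleigh quotient is an eigenvalue; it is at least `-c > -μ`, so the gap
`(-μ, μ)` pushes it up to `μ`. -/
theorem posDef_of_eigenvalues {T : Vec m →L[ℝ] Vec m} (hT : T.IsSymmetric) {μ c : ℝ} (hc : c < μ)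
    (heig : ∀ l : ℝ, Module.End.HasEigenvalue (T : Vec m →ₗ[ℝ] Vec m) l → μ ≤ |l|)
    (hlow : ∀ v, -(c * ‖v‖ ^ 2) ≤ inner ℝ v (T v)) (v : Vec m) :
    μ * ‖v‖ ^ 2 ≤ inner ℝ v (T v) := by
  rcases eq_or_ne v 0 with rfl | hv
  · simp
  have : Nontrivial (Vec m) := nontrivial_of_ne v 0 hv
  have hl := heig _ (LinearMap.IsSymmetric.hasEigenvalue_iInf_of_finiteDimensional hT)
  set l : ℝ := ⨅ x : {x : Vec m // x ≠ 0}, RCLike.re (inner ℝ ((T : Vec m →ₗ[ℝ] Vec m) x) (x : Vec m)) /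
    ‖(x : Vec m)‖ ^ 2 with hldef
  have hb : ∀ x : {x : Vec m // x ≠ 0}, -c ≤
      RCLike.re (inner ℝ ((T : Vec m →ₗ[ℝ] Vec m) x) (x : Vec m)) / ‖(x : Vec m)‖ ^ 2 := fun x => by
    have hx : 0 < ‖(x : Vec m)‖ := norm_pos_iff.2 x.2
    rw [le_div_iff₀ (by positivity)]
    have := hlow x
    rw [real_inner_comm] at this
    simpa using this
  have : Nonempty {x : Vec m // x ≠ 0} := ⟨⟨v, hv⟩⟩
  have hlc : -c ≤ l := le_ciInf hb
  have hlμ : μ ≤ l := by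
    change μ ≤ |l| at hl
    rcases le_or_gt 0 l with h | h
    · rwa [abs_of_nonneg h] at hl
    · rw [abs_of_neg h] at hl; linarith
  have h1 : l ≤ _ := ciInf_le ⟨-c, by rintro _ ⟨x, rfl⟩; exact hb x⟩ (⟨v, hv⟩ : {x : Vec m // x ≠ 0})
  have hvn : 0 < ‖v‖ := norm_pos_iff.2 hv
  rw [le_div_iff₀ (by positivity)] at h1
  have h2 : l * ‖v‖ ^ 2 ≤ inner ℝ (T v) v := by simpa using h1
  rw [real_inner_comm]
  exact (mul_le_mul_of_nonneg_right hlμ (by positivity)).trans h2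

/-- The constant `256/9` is `12 / (9/16)^(3/2)`. In the next lemma, `768 = 12 · 4³`. -/
theorem mul_sq_le_of_iter {Δ L a η K : ℝ} (hL : 0 < L) (ha : 0 < a) (hη : 0 ≤ η) (hK : 0 < K)
    (hsum : L / 12 * K * η ^ 3 ≤ Δ)
    (hiter : 256 * Δ * L ^ ((1 : ℝ) / 2) / (9 * a ^ ((3 : ℝ) / 2)) < K) :
    L * η ^ 2 ≤ 9 / 16 * a := by
  by_contra! h
  have h1 : (9 / 16 * a) ^ ((3 : ℝ) / 2) < (L * η ^ 2) ^ ((3 : ℝ) / 2) :=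
    Real.rpow_lt_rpow (by positivity) h (by norm_num)
  have e1 : (9 / 16 * a) ^ ((3 : ℝ) / 2) = 27 / 64 * a ^ ((3 : ℝ) / 2) := by
    rw [Real.mul_rpow (by norm_num) ha.le]
    have : (9 / 16 : ℝ) = (3 / 4) ^ (2 : ℝ) := by norm_num
    rw [this, ← Real.rpow_mul (by norm_num)]
    norm_num
  have e2 : (L * η ^ 2) ^ ((3 : ℝ) / 2) = L * L ^ ((1 : ℝ) / 2) * η ^ 3 := by
    rw [Real.mul_rpow hL.le (by positivity), ← Real.rpow_natCast η 2, ← Real.rpow_mul hη,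
      ← Real.rpow_natCast η 3]
    have : (3 : ℝ) / 2 = 1 + 1 / 2 := by norm_num
    rw [this, Real.rpow_add hL, Real.rpow_one]
    norm_num
  rw [e1, e2] at h1
  set b := L ^ ((1 : ℝ) / 2) with hb
  have hb0 : 0 < b := by positivity
  set c := a ^ ((3 : ℝ) / 2) with hc
  have hc0 : 0 < c := by positivity
  rw [div_lt_iff₀ (by positivity)] at hiter
  have h2 := mul_lt_mul_of_pos_right h1 hK
  have h3 := mul_le_mul_of_nonneg_left hsum hb0.le
  linarith

theorem four_mul_le_of_iter {Δ L μ η K : ℝ} (hL : 0 < L) (hμ : 0 < μ) (hK : 0 < K)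
    (hsum : L / 12 * K * η ^ 3 ≤ Δ) (hiter : 768 * Δ * L ^ 2 / μ ^ 3 < K) : 4 * L * η ≤ μ := by
  by_contra! h
  have h1 : μ ^ 3 < (4 * L * η) ^ 3 := pow_lt_pow_left₀ h hμ.le (by norm_num)
  rw [div_lt_iff₀ (by positivity)] at hiter
  have h2 := mul_lt_mul_of_pos_right h1 hK
  have h3 := mul_le_mul_of_nonneg_left hsum (by positivity : (0 : ℝ) ≤ L ^ 2)
  linarith

theorem stationarity_nonneg (M : ℝ) (x : Vec n) (y : Vec m) : 0 ≤ stationarity M g x y :=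
  le_max_of_le_left (Real.sqrt_nonneg _)

theorem norm_gradY_le_stationarity (hL : 0 < L) (x : Vec n) (y : Vec m) :
    ‖gradY g x y‖ ≤ L * stationarity L g x y ^ 2 := by
  have h : √(1 / L * ‖gradY g x y‖) ≤ stationarity L g x y := le_max_left _ _
  rw [Real.sqrt_le_left (stationarity_nonneg _ _ _), one_div, inv_mul_le_iff₀ hL] at h
  exact h

theorem hessY_ge_stationarity (hL : 0 < L) (x : Vec n) (y v : Vec m) :
    -(3 * L / 2 * stationarity L g x y * ‖v‖ ^ 2) ≤ inner ℝ v (hessY g x y v) := by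
  have h : -(2 / (3 * L)) * lambdaMin (hessY g x y) ≤ stationarity L g x y := le_max_right _ _
  have h1 : -(3 * L / 2 * stationarity L g x y) ≤ lambdaMin (hessY g x y) := by
    have := mul_le_mul_of_nonneg_left h (by positivity : (0 : ℝ) ≤ 3 * L / 2)
    have e : 3 * L / 2 * (-(2 / (3 * L)) * lambdaMin (hessY g x y)) = -lambdaMin (hessY g x y) := by
      field_simp
    linarith
  have h2 := mul_le_mul_of_nonneg_right h1 (sq_nonneg ‖v‖)
  linarith [lambdaMin_mul_le (hessY g x y) v]

theorem stationarity_step_le (hstd : StandingAssumptions f g X Y y₀ gLow L) {x : Vec n}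
    (hx : x ∈ X) {y : ℕ → Vec m} (hrun : IsCubicNewtonRun L g y₀ x y) (k : ℕ) :
    stationarity L g x (y (k + 1)) ≤ ‖y (k + 1) - y k‖ := by
  have hL := hstd.L_pos
  have hh := hstd.hasLipschitzHessian hx
  have h1 := hh.norm_grad_step_le hL.le (hrun.2 k)
  have h2 := hh.inner_hess_step_ge (hrun.2 k)
  rw [add_sub_cancel] at h1
  simp only [add_sub_cancel] at h2
  refine max_le ?_ ?_
  · rw [Real.sqrt_le_left (norm_nonneg _), one_div, inv_mul_le_iff₀ hL]
    exact h1
  · have h3 := le_lambdaMin (by positivity) h2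
    rw [neg_mul, neg_le, neg_eq_neg_one_mul]
    have := mul_le_mul_of_nonneg_left h3 (by positivity : (0 : ℝ) ≤ 2 / (3 * L))
    refine le_trans (le_of_eq ?_) this
    field_simp

theorem run_mem_sublevel (hstd : StandingAssumptions f g X Y y₀ gLow L) {x : Vec n}
    (hx : x ∈ X) {y : ℕ → Vec m} (hrun : IsCubicNewtonRun L g y₀ x y) (k : ℕ) :
    g x (y k) ≤ g x y₀ := by
  have hL := hstd.L_pos
  have h := (hstd.hasLipschitzHessian hx).sum_step_le hrun.2 k
  have h0 : 0 ≤ ∑ j ∈ Finset.range k, L / 12 * ‖y (j + 1) - y j‖ ^ 3 :=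
    Finset.sum_nonneg fun j _ => by positivity
  rw [hrun.1] at h
  linarith

theorem clusterPt_mem_sublevel (hstd : StandingAssumptions f g X Y y₀ gLow L) {x : Vec n}
    (hx : x ∈ X) {y : ℕ → Vec m} (hrun : IsCubicNewtonRun L g y₀ x y) {p : Vec m}
    (hp : MapClusterPt p atTop y) : g x p ≤ g x y₀ := by
  obtain ⟨φ, -, hlim⟩ := hp.tendsto_subseq
  exact (hstd.level_compact x hx).isClosed.mem_of_tendsto hlim
    (Eventually.of_forall fun k => run_mem_sublevel hstd hx hrun _)

/-- The measure at the output is at most that at each of `y 1, …, y K`, hence at most each of the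
`K` step lengths, whose cubes telescope. -/
theorem stationarity_output_le (hstd : StandingAssumptions f g X Y y₀ gLow L) {x : Vec n}
    (hx : x ∈ X) {gBar : ℝ} (hgBar : g x y₀ ≤ gBar) {y : ℕ → Vec m}
    (hrun : IsCubicNewtonRun L g y₀ x y) {K : ℕ} {yhat : Vec m}
    (hout : IsCubicNewtonOutput L g x y K yhat) :
    L / 12 * K * stationarity L g x yhat ^ 3 ≤ gBar - gLow := by
  have hL := hstd.L_pos
  obtain ⟨k, -, rfl, hmin⟩ := hout
  have h := (hstd.hasLipschitzHessian hx).sum_step_le hrun.2 K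
  have h1 : ∑ j ∈ Finset.range K, L / 12 * stationarity L g x (y k) ^ 3 ≤
      ∑ j ∈ Finset.range K, L / 12 * ‖y (j + 1) - y j‖ ^ 3 := by
    refine Finset.sum_le_sum fun j hj => ?_
    have := (hmin (j + 1) (Finset.mem_range.1 hj)).trans (stationarity_step_le hstd hx hrun j)
    have h0 := stationarity_nonneg (g := g) L x (y k)
    gcongr
  rw [Finset.sum_const, Finset.card_range, nsmul_eq_mul] at h1
  rw [hrun.1] at h
  have := hstd.g_lower x hx (y K)
  linarith

/-- Away from the bifurcation set, the output of the method is close to the limit of the run. -/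
theorem norm_output_sub_le (hstd : StandingAssumptions f g X Y y₀ gLow L) (hY' : IsCompact Y')
    {x : Vec n} (hx : x ∈ X) {gBar : ℝ} (hgBar : g x y₀ ≤ gBar) {μ a ρ : ℝ} (hμ : 0 < μ)
    (heig : ∀ y ∈ Y', gradY g x y = 0 →
      ∀ l : ℝ, Module.End.HasEigenvalue (hessY g x y : Vec m →ₗ[ℝ] Vec m) l → μ ≤ |l|)
    (ha : 0 < a)
    (hgrad : ∀ y ∈ Y \ Metric.cthickening (μ / (2 * L)) (critSet g Y' x), a ≤ ‖gradY g x y‖)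
    (hρ : 0 < ρ) {K : ℕ} (hK : iterBound₁ gBar gLow L μ a + iterBound₂ gBar gLow L μ ρ < K)
    {y : ℕ → Vec m} (hrun : IsCubicNewtonRun L g y₀ x y) {yhat p : Vec m}
    (hout : IsCubicNewtonOutput L g x y K yhat) (hp : MapClusterPt p atTop y) :
    ‖p - yhat‖ ≤ ρ := by
  have hL := hstd.L_pos
  have hh := hstd.hasLipschitzHessian hx
  have hΔ : 0 ≤ gBar - gLow := by linarith [hstd.g_lower x hx y₀]
  have hm : 0 < min a (μ ^ 2 / (4 * L)) := lt_min ha (by positivity)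
  have h2nn : 0 ≤ iterBound₂ gBar gLow L μ ρ := by unfold iterBound₂; positivity
  have hA : 0 ≤ 256 * (gBar - gLow) * L ^ ((1 : ℝ) / 2) /
      (9 * (min a (μ ^ 2 / (4 * L))) ^ ((3 : ℝ) / 2)) := by positivity
  have h1nn : 0 ≤ iterBound₁ gBar gLow L μ a := hA.trans (le_max_left _ _)
  have hK0 : (0 : ℝ) < K := by linarith
  have hK1 : iterBound₁ gBar gLow L μ a < K := by linarith
  have hKa := (le_max_left _ _).trans_lt hK1
  have hKb := (le_max_right _ _).trans_lt hK1
  have hKc : iterBound₂ gBar gLow L μ ρ < K := by linarith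
  have hsum := stationarity_output_le hstd hx hgBar hrun hout
  have hη := stationarity_nonneg (g := g) L x yhat
  have hga := mul_sq_le_of_iter hL hm hη hK0 hsum hKa
  have hgc := mul_sq_le_of_iter hL (by positivity) hη hK0 hsum hKc
  have hlb := four_mul_le_of_iter hL hμ hK0 hsum hKb
  have hG := norm_gradY_le_stationarity (g := g) hL x yhat
  have hH := hessY_ge_stationarity (g := g) hL x yhat
  obtain ⟨k, -, rfl, -⟩ := hout
  have hYk : y k ∈ Y := hstd.level_subset x hx (run_mem_sublevel hstd hx hrun k)
  have hclose : y k ∈ Metric.cthickening (μ / (2 * L)) (critSet g Y' x) := by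
    by_contra h
    have := hgrad _ ⟨hYk, h⟩
    have := min_le_left a (μ ^ 2 / (4 * L))
    linarith
  have hcrit : IsCompact (critSet g Y' x) := by
    have hcont : Continuous (gradY g x) :=
      continuous_iff_continuousAt.2 fun y => (hh.hess y).continuousAt
    exact hY'.inter_right (isClosed_eq hcont continuous_const)
  rw [hcrit.cthickening_eq_biUnion_closedBall (by positivity)] at hclose
  simp only [mem_iUnion, Metric.mem_closedBall, dist_eq_norm, exists_prop] at hclose
  obtain ⟨q, ⟨hqY, hq0⟩, hdist⟩ := hclose
  have hpos : ∀ v, μ * ‖v‖ ^ 2 ≤ inner ℝ v (hessY g x q v) := by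
    -- At the output the Hessian is at least `-3μ/8`, and moving to `q` costs at most another `μ/2`.
    refine posDef_of_eigenvalues (hh.symm q) (c := 7 / 8 * μ) (by linarith) (heig q hqY hq0)
      fun v => ?_
    have h1 := hh.inner_hess_ge (y k) q v
    have h2 := hH v
    have h3 : L * ‖y k - q‖ ≤ μ / 2 := by
      rw [le_div_iff₀ (by positivity)] at hdist
      linarith
    have h4 := mul_le_mul_of_nonneg_right h3 (sq_nonneg ‖v‖)
    have h5 := mul_le_mul_of_nonneg_right hlb (sq_nonneg ‖v‖)
    linarith
  have hGy : ‖gradY g x (y k)‖ ≤ 9 / 64 * (μ ^ 2 / L) := by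
    have := min_le_right a (μ ^ 2 / (4 * L))
    have e : μ ^ 2 / (4 * L) = 1 / 4 * (μ ^ 2 / L) := by field_simp
    linarith [hG, hga]
  have hlim := hh.tendsto_of_near hμ hL hq0 hpos hrun.2 hdist hGy
  obtain ⟨φ, hφ, hsub⟩ := hp.tendsto_subseq
  have hpq : p = q := tendsto_nhds_unique hsub (hlim.comp hφ.tendsto_atTop)
  have herr := hh.dist_le_of_near hL hq0 hpos hdist
  rw [hpq, norm_sub_rev]
  -- From `3/4 μ ‖y k - q‖ ≤ ‖∇g‖ ≤ 9/16 · μρ/2` the distance is in fact at most `3/8 ρ`.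
  refine le_of_mul_le_mul_left ?_ hμ
  nlinarith [mul_pos hμ hρ]

end Output

/-! ### The Gaussian kernel and differentiation of the smoothing -/

section Kernel

variable {n : ℕ} {ξ : ℝ}

theorem hasGradientAt_gaussKernel (ξ : ℝ) (z : Vec n) :
    HasGradientAt (gaussKernel ξ) (-(gaussKernel ξ z / ξ ^ 2) • z) z := by
  rw [hasGradientAt_iff_hasFDerivAt]
  have h1 : HasFDerivAt (fun z : Vec n => ‖z‖ ^ 2) (2 • innerSL ℝ z) z :=
    (hasStrictFDerivAt_norm_sq z).hasFDerivAt
  have h2 := ((h1.neg.mul_const (2 * ξ ^ 2)⁻¹).exp).const_mul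
    (1 / (2 * Real.pi * ξ ^ 2) ^ ((n : ℝ) / 2))
  refine h2.congr_fderiv ?_
  ext v
  simp [gaussKernel, div_eq_mul_inv]
  ring

theorem gradient_gaussKernel (ξ : ℝ) (z : Vec n) :
    gradient (gaussKernel ξ) z = -(gaussKernel ξ z / ξ ^ 2) • z :=
  (hasGradientAt_gaussKernel ξ z).gradient

theorem continuous_gaussKernel (ξ : ℝ) : Continuous (gaussKernel ξ : Vec n → ℝ) := by
  unfold gaussKernel; fun_prop

theorem continuous_gradient_gaussKernel (ξ : ℝ) :
    Continuous (gradient (gaussKernel ξ : Vec n → ℝ)) := by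
  have : gradient (gaussKernel ξ : Vec n → ℝ) = fun z => -(gaussKernel ξ z / ξ ^ 2) • z :=
    funext (gradient_gaussKernel ξ)
  rw [this]
  have := continuous_gaussKernel (n := n) ξ
  fun_prop

/-- A uniform bound of the gradient of the Gaussian kernel. -/
noncomputable def gaussGradBound (n : ℕ) (ξ : ℝ) : ℝ :=
  1 / (2 * Real.pi * ξ ^ 2) ^ ((n : ℝ) / 2) / ξ ^ 2 * (1 + 2 * ξ ^ 2)

theorem gaussGradBound_nonneg (n : ℕ) (ξ : ℝ) : 0 ≤ gaussGradBound n ξ := by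
  unfold gaussGradBound; positivity

/-- Half of the Gaussian decay is spent on absorbing the factor `‖z‖`. -/
theorem norm_gradient_gaussKernel_le (hξ : 0 < ξ) (z : Vec n) :
    ‖gradient (gaussKernel ξ) z‖ ≤ gaussGradBound n ξ * Real.exp (-(1 / (4 * ξ ^ 2)) * ‖z‖ ^ 2) := by
  rw [gradient_gaussKernel, norm_smul, norm_neg, gaussKernel, gaussGradBound]
  set c := 1 / (2 * Real.pi * ξ ^ 2) ^ ((n : ℝ) / 2)
  have hc : 0 ≤ c := by positivity
  rw [Real.norm_of_nonneg (by positivity)]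
  set t := ‖z‖
  have h1 : t ≤ (1 + 2 * ξ ^ 2) * Real.exp (1 / (4 * ξ ^ 2) * t ^ 2) := by
    have h2 := Real.add_one_le_exp (1 / (4 * ξ ^ 2) * t ^ 2)
    have h3 : t ≤ (1 + 2 * ξ ^ 2) * (1 / (4 * ξ ^ 2) * t ^ 2 + 1) := by
      have e : (1 + 2 * ξ ^ 2) * (1 / (4 * ξ ^ 2) * t ^ 2 + 1) =
          1 / (4 * ξ ^ 2) * t ^ 2 + 2 * ξ ^ 2 + (1 + t ^ 2 / 2) := by field_simp; ring
      have h4 : 0 ≤ 1 / (4 * ξ ^ 2) * t ^ 2 := by positivity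
      rw [e]
      nlinarith [sq_nonneg (t - 1)]
    exact h3.trans (mul_le_mul_of_nonneg_left h2 (by positivity))
  have e : Real.exp (-t ^ 2 / (2 * ξ ^ 2)) * Real.exp (1 / (4 * ξ ^ 2) * t ^ 2) =
      Real.exp (-(1 / (4 * ξ ^ 2)) * t ^ 2) := by
    rw [← Real.exp_add]; congr 1; field_simp; ring
  calc c * Real.exp (-t ^ 2 / (2 * ξ ^ 2)) / ξ ^ 2 * t
      ≤ c * Real.exp (-t ^ 2 / (2 * ξ ^ 2)) / ξ ^ 2 *
        ((1 + 2 * ξ ^ 2) * Real.exp (1 / (4 * ξ ^ 2) * t ^ 2)) := by gcongr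
    _ = c / ξ ^ 2 * (1 + 2 * ξ ^ 2) *
        (Real.exp (-t ^ 2 / (2 * ξ ^ 2)) * Real.exp (1 / (4 * ξ ^ 2) * t ^ 2)) := by ring
    _ = _ := by rw [e]

theorem norm_gradient_gaussKernel_le_const (hξ : 0 < ξ) (z : Vec n) :
    ‖gradient (gaussKernel ξ) z‖ ≤ gaussGradBound n ξ := by
  refine (norm_gradient_gaussKernel_le hξ z).trans
    (mul_le_of_le_one_right (gaussGradBound_nonneg n ξ) (Real.exp_le_one_iff.2 ?_))
  rw [neg_mul]
  exact neg_nonpos.2 (by positivity)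

theorem integrable_exp_neg_mul_norm_sq {b : ℝ} (hb : 0 < b) :
    Integrable fun z : Vec n => Real.exp (-b * ‖z‖ ^ 2) := by
  have h := (GaussianFourier.integrable_cexp_neg_mul_sq_norm_add (b := (b : ℂ)) (V := Vec n)
    (by simpa using hb) 0 0).norm
  refine h.congr (Eventually.of_forall fun z => ?_)
  simp only [Complex.norm_exp]
  congr 1
  simp [← Complex.ofReal_pow]

theorem integrable_gaussKernel (hξ : 0 < ξ) : Integrable (gaussKernel ξ : Vec n → ℝ) := by
  have h := (integrable_exp_neg_mul_norm_sq (n := n) (b := 1 / (2 * ξ ^ 2))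
    (by positivity)).const_mul (1 / (2 * Real.pi * ξ ^ 2) ^ ((n : ℝ) / 2))
  refine h.congr (Eventually.of_forall fun z => ?_)
  simp only [gaussKernel]
  congr 2
  ring

theorem integrable_gradient_gaussKernel (hξ : 0 < ξ) :
    Integrable (gradient (gaussKernel ξ : Vec n → ℝ)) := by
  refine ((integrable_exp_neg_mul_norm_sq (n := n) (b := 1 / (4 * ξ ^ 2))
    (by positivity)).const_mul (gaussGradBound n ξ)).mono'
    (continuous_gradient_gaussKernel ξ).aestronglyMeasurable
    (Eventually.of_forall (norm_gradient_gaussKernel_le hξ))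

theorem integrable_smul_gradient_gaussKernel (hξ : 0 < ξ) {φ : Vec n → ℝ}
    (hφ : AEStronglyMeasurable φ volume) {C : ℝ} (hC : ∀ z, |φ z| ≤ C) (x : Vec n) :
    Integrable fun z => φ z • gradient (gaussKernel ξ) (x - z) :=
  ((integrable_gradient_gaussKernel hξ).comp_sub_left x).bdd_smul C hφ (Eventually.of_forall hC)

theorem hasGradientAt_gaussSmooth (hξ : 0 < ξ) {φ : Vec n → ℝ}
    (hφ : AEStronglyMeasurable φ volume) {C : ℝ} (hC : ∀ z, |φ z| ≤ C) (x : Vec n) :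
    HasGradientAt (gaussSmooth ξ φ) (kernelGradIntegral ξ φ x) x := by
  have hC0 : 0 ≤ C := (abs_nonneg _).trans (hC 0)
  have hker : ∀ x : Vec n, AEStronglyMeasurable (fun z => gaussKernel ξ (x - z) * φ z) volume :=
    fun x => ((continuous_gaussKernel ξ).comp (by fun_prop)).aestronglyMeasurable.mul hφ
  have hint := integrable_smul_gradient_gaussKernel hξ hφ hC x
  -- Halving the decay rate again gives one dominating function for all `x'` in the unit ball about
  -- `x`, through `‖x - z‖² ≤ 2 ‖x' - z‖² + 2`.
  set b := 1 / (8 * ξ ^ 2) with hb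
  have hb0 : 0 < b := by positivity
  have key := hasFDerivAt_integral_of_dominated_of_fderiv_le (μ := volume) (𝕜 := ℝ)
    (F := fun (x z : Vec n) => gaussKernel ξ (x - z) * φ z)
    (F' := fun x z => innerSL ℝ (φ z • gradient (gaussKernel ξ) (x - z)))
    (x₀ := x) (s := Metric.ball x 1)
    (bound := fun z => C * (gaussGradBound n ξ * (Real.exp (2 * b) * Real.exp (-b * ‖x - z‖ ^ 2))))
    (Metric.ball_mem_nhds x one_pos) (Eventually.of_forall hker) ?_ ?_ ?_ ?_ ?_
  · rw [hasGradientAt_iff_hasFDerivAt]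
    refine key.congr_fderiv ?_
    rw [(innerSL ℝ).integral_comp_comm hint]
    rfl
  · exact ((integrable_gaussKernel hξ).comp_sub_left x).mul_bdd hφ (Eventually.of_forall hC)
  · exact (innerSL ℝ).continuous.comp_aestronglyMeasurable hint.aestronglyMeasurable
  · refine Eventually.of_forall fun z x' hx' => ?_
    rw [innerSL_apply_norm, norm_smul]
    refine mul_le_mul (hC z) ((norm_gradient_gaussKernel_le hξ _).trans ?_) (norm_nonneg _) hC0
    refine mul_le_mul_of_nonneg_left ?_ (gaussGradBound_nonneg n ξ)
    rw [← Real.exp_add, Real.exp_le_exp]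
    rw [Metric.mem_ball, dist_eq_norm] at hx'
    have h1 : ‖x - z‖ ≤ ‖x' - z‖ + 1 := by
      have e : x - z = (x' - z) - (x' - x) := by abel
      rw [e]
      exact (norm_sub_le _ _).trans (by linarith)
    have h2 : ‖x - z‖ ^ 2 ≤ 2 * ‖x' - z‖ ^ 2 + 2 := by
      have := pow_le_pow_left₀ (norm_nonneg _) h1 2
      nlinarith [sq_nonneg (‖x' - z‖ - 1)]
    have e : 1 / (4 * ξ ^ 2) = 2 * b := by rw [hb]; field_simp; norm_num
    rw [e]
    nlinarith
  · exact ((((integrable_exp_neg_mul_norm_sq hb0).comp_sub_left x).const_mul _).const_mul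
      _).const_mul _
  · refine Eventually.of_forall fun z x' _ => ?_
    have h1 := (hasGradientAt_gaussKernel ξ (x' - z)).hasFDerivAt
    rw [← gradient_gaussKernel] at h1
    have h2 := (h1.comp x' ((hasFDerivAt_id x').sub_const z)).mul_const (φ z)
    refine h2.congr_fderiv ?_
    ext v
    simp

/-- The uniform error `A` is paired with the `L¹` norm of the kernel gradient, the large error on
`S` with its supremum. -/
theorem norm_kernelGradIntegral_sub_le (hξ : 0 < ξ) {φ ψ : Vec n → ℝ}
    (hφ : AEStronglyMeasurable φ volume) (hψ : AEStronglyMeasurable ψ volume) {C A B : ℝ}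
    (hφC : ∀ z, |φ z| ≤ C) (hψC : ∀ z, |ψ z| ≤ C) {S : Set (Vec n)} (hS : MeasurableSet S)
    (hSfin : volume S ≠ ⊤) (hB : 0 ≤ B) (hAB : ∀ z, |φ z - ψ z| ≤ A + S.indicator (fun _ => B) z)
    (x : Vec n) :
    ‖kernelGradIntegral ξ φ x - kernelGradIntegral ξ ψ x‖ ≤
      A * (∫ z : Vec n, ‖gradient (gaussKernel ξ) z‖) +
        gaussGradBound n ξ * (B * volume.real S) := by
  rw [kernelGradIntegral, kernelGradIntegral,
    ← integral_sub (integrable_smul_gradient_gaussKernel hξ hφ hφC x)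
      (integrable_smul_gradient_gaussKernel hξ hψ hψC x)]
  have hg := ((integrable_gradient_gaussKernel (n := n) hξ).comp_sub_left x).norm
  have hind : Integrable (S.indicator fun _ : Vec n => B) volume :=
    (integrable_indicator_iff hS).2 (integrableOn_const hSfin)
  have hbound : Integrable (fun z => A * ‖gradient (gaussKernel ξ) (x - z)‖ +
      gaussGradBound n ξ * S.indicator (fun _ => B) z) volume :=
    (hg.const_mul A).add (hind.const_mul _)
  refine (norm_integral_le_of_norm_le hbound (Eventually.of_forall fun z => ?_)).trans
    (le_of_eq ?_)
  · rw [← sub_smul, norm_smul]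
    have h1 := mul_le_mul_of_nonneg_right (hAB z) (norm_nonneg (gradient (gaussKernel ξ) (x - z)))
    have h2 : 0 ≤ S.indicator (fun _ => B) z := indicator_nonneg (fun _ _ => hB) z
    have h3 := mul_le_mul_of_nonneg_left (norm_gradient_gaussKernel_le_const hξ (x - z)) h2
    rw [Real.norm_eq_abs]
    linarith
  · rw [integral_add (hg.const_mul A) (hind.const_mul _), integral_const_mul, integral_const_mul,
      integral_sub_left_eq_self (fun z : Vec n => ‖gradient (gaussKernel ξ) z‖),
      integral_indicator_const _ hS, smul_eq_mul, mul_comm B]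

end Kernel

/-! ### Measurability and bounds of the integrands -/

section Comparison

variable {n m : ℕ} {f g : Vec n → Vec m → ℝ} {X : Set (Vec n)} {Y : Set (Vec m)}
  {y₀ : Vec m} {gLow L fBar : ℝ}

theorem aestronglyMeasurable_extendedValue (hX : IsCompact X) {w : Vec n → Vec m}
    (hw : AEStronglyMeasurable (fun z => f z (w z)) (volume.restrict X)) :
    AEStronglyMeasurable (extendedValue f X fBar w) volume := by
  classical
  have h : extendedValue f X fBar w = X.piecewise (fun z => f z (w z)) fun _ => fBar := by
    ext z; rfl
  rw [h]
  exact AEStronglyMeasurable.piecewise hX.measurableSet hw aestronglyMeasurable_const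

/-- The bound is `|fBar|` because `fBar` may be negative when `X` is empty. -/
theorem abs_extendedValue_le {w : Vec n → Vec m} (hw : ∀ z ∈ X, |f z (w z)| ≤ fBar) (z : Vec n) :
    |extendedValue f X fBar w z| ≤ |fBar| := by
  rw [extendedValue]
  split_ifs with h
  · exact (hw z h).trans (le_abs_self _)
  · exact le_rfl

theorem aestronglyMeasurable_of_ae_continuous (hstd : StandingAssumptions f g X Y y₀ gLow L)
    {w : Vec n → Vec m} (hw : volume {z | z ∈ X ∧ ¬ ContinuousWithinAt w X z} = 0) :
    AEStronglyMeasurable (fun z => f z (w z)) (volume.restrict X) := by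
  -- The discontinuity set itself need not be measurable; a null measurable hull replaces it.
  set N := toMeasurable volume {z | z ∈ X ∧ ¬ ContinuousWithinAt w X z} with hN
  have hN0 : volume N = 0 := by rw [hN, measure_toMeasurable, hw]
  have hcont : ContinuousOn (fun z => f z (w z)) (X \ N) := by
    have hwc : ContinuousOn w (X \ N) := fun z hz => by
      have : ContinuousWithinAt w X z := by
        by_contra h
        exact hz.2 (subset_toMeasurable _ _ ⟨hz.1, h⟩)
      exact this.mono sdiff_subset
    exact hstd.f_continuous.comp (continuousOn_id.prodMk hwc) fun z hz => ⟨hz.1, mem_univ _⟩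
  have hmeas : MeasurableSet (X \ N) :=
    hstd.X_compact.measurableSet.diff (measurableSet_toMeasurable _ _)
  have h := hcont.aestronglyMeasurable (μ := volume) hmeas
  have he : volume.restrict (X \ N) = volume.restrict X :=
    Measure.restrict_congr_set (sdiff_null_ae_eq_self hN0)
  rwa [he] at h

end Comparison

end SmoothedBilevel

/-! ### The main estimate -/

open SmoothedBilevel in
theorem mainTheorem9 {n m : ℕ} (f g : SmoothedBilevel.Vec n → SmoothedBilevel.Vec m → ℝ)
    (X : Set (SmoothedBilevel.Vec n)) (Y Y' : Set (SmoothedBilevel.Vec m))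
    (y₀ : SmoothedBilevel.Vec m) (gLow gBar L Lf fBar d : ℝ)
    (hstd : SmoothedBilevel.StandingAssumptions f g X Y y₀ gLow L)
    (hgBar : ∀ x ∈ X, g x y₀ ≤ gBar)
    (hLf : ∀ x ∈ X, ∀ x' ∈ X, ∀ y y' : SmoothedBilevel.Vec m, g x y ≤ g x y₀ →
      g x' y' ≤ g x' y₀ → |f x y - f x' y'| ≤ Lf * SmoothedBilevel.pairDist x x' y y')
    (hfBar : ∀ x ∈ X, ∀ y : SmoothedBilevel.Vec m, g x y ≤ g x y₀ → |f x y| ≤ fBar)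
    (hY' : IsCompact Y') (hYY' : Y ⊆ interior Y')
    (hd : d = SmoothedBilevel.upperMinkowskiDim (SmoothedBilevel.bifurcationSet g X))
    (hdn : d < n) :
    (∃ (μ : ℝ → ℝ) (α : ℝ → ℝ → ℝ), SmoothedBilevel.IsEigenvalueBound g X Y' μ ∧
      SmoothedBilevel.IsGradientBound g X Y Y' α) ∧
    ∃ C₁ C₂ : ℝ → ℝ,
      ∀ (run : SmoothedBilevel.Vec n → ℕ → SmoothedBilevel.Vec m)
        (ycd : SmoothedBilevel.Vec n → SmoothedBilevel.Vec m),
      (∀ z ∈ X, SmoothedBilevel.IsCubicNewtonRun L g y₀ z (run z)) →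
      (∀ z ∈ X, SmoothedBilevel.IsCorrespondenceSolution f g z (run z) (ycd z)) →
      MeasureTheory.volume {z | z ∈ X \ SmoothedBilevel.bifurcationSet g X ∧
        ¬ ContinuousWithinAt ycd X z} = 0 →
      ∀ (μ : ℝ → ℝ) (α : ℝ → ℝ → ℝ), SmoothedBilevel.IsEigenvalueBound g X Y' μ →
      SmoothedBilevel.IsGradientBound g X Y Y' α →
      ∀ (ξ ρ δ : ℝ) (K : ℕ), 0 < ξ → 0 < ρ → 0 < δ →
      SmoothedBilevel.iterBound₁ gBar gLow L (μ δ) (α δ (μ δ / (2 * L))) +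
        SmoothedBilevel.iterBound₂ gBar gLow L (μ δ) ρ < K →
      ∀ yhat : SmoothedBilevel.Vec n → SmoothedBilevel.Vec m,
      (∀ z ∈ X, SmoothedBilevel.IsCubicNewtonOutput L g z (run z) K (yhat z)) →
      MeasureTheory.AEStronglyMeasurable (fun z => f z (yhat z))
        (MeasureTheory.volume.restrict X) →
      ∀ x : SmoothedBilevel.Vec n,
        DifferentiableAt ℝ (SmoothedBilevel.gaussSmooth ξ
          (SmoothedBilevel.extendedValue f X fBar ycd)) x ∧
        MeasureTheory.Integrable (fun z => SmoothedBilevel.extendedValue f X fBar yhat z •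
          gradient (SmoothedBilevel.gaussKernel ξ) (x - z)) ∧
        ‖gradient (SmoothedBilevel.gaussSmooth ξ
            (SmoothedBilevel.extendedValue f X fBar ycd)) x -
          SmoothedBilevel.kernelGradIntegral ξ
            (SmoothedBilevel.extendedValue f X fBar yhat) x‖
          ≤ C₁ ξ * ρ + C₂ ξ * δ ^ (((n : ℝ) - d) / 2) := by
  subst hd
  refine ⟨?_, ?_⟩
  · obtain ⟨μ, hμ⟩ := exists_isEigenvalueBound hstd hY'
    obtain ⟨α, hα⟩ := exists_isGradientBound hstd hYY'
    exact ⟨μ, α, hμ, hα⟩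
  have hXb := hstd.X_compact.isBounded
  have hbif : Bornology.IsBounded (bifurcationSet g X) := hXb.subset fun x hx => hx.1
  obtain ⟨V, -, hV⟩ := exists_volume_inter_cthickening_le hbif hXb hdn
  refine ⟨fun ξ => |Lf| * ∫ z : Vec n, ‖gradient (gaussKernel ξ) z‖,
    fun ξ => gaussGradBound n ξ * (2 * |fBar|) * V, ?_⟩
  intro run ycd hrun hycd hdisc μ α hμ hα ξ ρ δ K hξ hρ hδ hK yhat hyhat hmeas x
  have hcd_level : ∀ z ∈ X, g z (ycd z) ≤ g z y₀ := fun z hz =>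
    clusterPt_mem_sublevel hstd hz (hrun z hz) (hycd z hz).1.1
  have hhat_level : ∀ z ∈ X, g z (yhat z) ≤ g z y₀ := fun z hz => by
    obtain ⟨k, -, hk, -⟩ := hyhat z hz
    rw [hk]
    exact run_mem_sublevel hstd hz (hrun z hz) k
  have hcd_meas : AEStronglyMeasurable (extendedValue f X fBar ycd) volume := by
    refine aestronglyMeasurable_extendedValue hstd.X_compact
      (aestronglyMeasurable_of_ae_continuous hstd ?_)
    -- `ycd` may be discontinuous on the whole bifurcation set, but that set is null because `d <
    -- n`.
    refine measure_mono_null (t := {z | z ∈ X \ bifurcationSet g X ∧ ¬ ContinuousWithinAt ycd X z} ∪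
      bifurcationSet g X) ?_
      (measure_union_null hdisc (volume_eq_zero_of_upperMinkowskiDim_lt hbif hdn))
    rintro z ⟨hz, hzc⟩
    by_cases hzb : z ∈ bifurcationSet g X
    · exact Or.inr hzb
    · exact Or.inl ⟨⟨hz, hzb⟩, hzc⟩
  have hhat_meas : AEStronglyMeasurable (extendedValue f X fBar yhat) volume :=
    aestronglyMeasurable_extendedValue hstd.X_compact hmeas
  have hcd_bd := abs_extendedValue_le (f := f) (X := X) (fBar := fBar) (w := ycd)
    fun z hz => hfBar z hz _ (hcd_level z hz)
  have hhat_bd := abs_extendedValue_le (f := f) (X := X) (fBar := fBar) (w := yhat)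
    fun z hz => hfBar z hz _ (hhat_level z hz)
  have hgrad := hasGradientAt_gaussSmooth hξ hcd_meas hcd_bd x
  refine ⟨hgrad.differentiableAt, integrable_smul_gradient_gaussKernel hξ hhat_meas hhat_bd x, ?_⟩
  rw [hgrad.gradient]
  have hSmeas : MeasurableSet (bifurcationNhd g X δ) :=
    hstd.X_compact.measurableSet.inter Metric.isClosed_cthickening.measurableSet
  have hSfin : volume (bifurcationNhd g X δ) ≠ ⊤ :=
    (hXb.subset inter_subset_left).measure_lt_top.ne
  have hmain := norm_kernelGradIntegral_sub_le hξ hcd_meas hhat_meas (A := |Lf| * ρ)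
    (B := 2 * |fBar|) hcd_bd hhat_bd hSmeas hSfin (by positivity) ?_ x
  · refine hmain.trans ?_
    have h1 := mul_le_mul_of_nonneg_left (hV δ hδ)
      (mul_nonneg (gaussGradBound_nonneg n ξ) (by positivity : 0 ≤ 2 * |fBar|))
    rw [bifurcationNhd]
    linarith
  · intro z
    by_cases hzX : z ∈ X
    · by_cases hzS : z ∈ bifurcationNhd g X δ
      · rw [indicator_of_mem hzS]
        have h1 := abs_sub (extendedValue f X fBar ycd z) (extendedValue f X fBar yhat z)
        have h2 : 0 ≤ |Lf| * ρ := by positivity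
        linarith [hcd_bd z, hhat_bd z]
      · rw [indicator_of_notMem hzS, add_zero, extendedValue, extendedValue, if_pos hzX,
          if_pos hzX]
        obtain ⟨hμ0, hμz⟩ := hμ δ hδ
        obtain ⟨hα0, hαz⟩ := hα δ hδ (μ δ / (2 * L)) (div_pos hμ0 (mul_pos two_pos hstd.L_pos))
        have hdist := norm_output_sub_le hstd hY' hzX (hgBar z hzX) hμ0 (hμz z ⟨hzX, hzS⟩) hα0
          (hαz z ⟨hzX, hzS⟩) hρ hK (hrun z hzX) (hyhat z hzX) (hycd z hzX).1.1
        have h1 := hLf z hzX z hzX _ _ (hcd_level z hzX) (hhat_level z hzX)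
        rw [pairDist_self_left] at h1
        calc _ ≤ Lf * ‖ycd z - yhat z‖ := h1
          _ ≤ |Lf| * ‖ycd z - yhat z‖ := by gcongr; exact le_abs_self _
          _ ≤ |Lf| * ρ := by gcongr
    · have h0 : 0 ≤ (bifurcationNhd g X δ).indicator (fun _ => 2 * |fBar|) z :=
        indicator_nonneg (fun _ _ => by positivity) z
      rw [extendedValue, extendedValue, if_neg hzX, if_neg hzX, sub_self, abs_zero]
      positivity
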